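/- Let $\hat f(z)=\sum_{p\ge 1} f_p z^p\in\mathbb C[[z]]$ be a formal power series without constant term. The following three statements are equivalent. (1) There are polynomials $P,Q\in\mathbb C[z]$ with $P(0)\neq 0$ such that $\hat f$ is a formal solution of $P(z^2\partial_z+z)\,y=Q(z)$. (2) There are an integer $r\ge 1$ and $a_1,\dots,a_r\in\mathbb C$ such that $$f_j=\sum_{k=1}^{r} a_k\, j(j-1)\cdots(j-k+1)\, f_{j-k}\qquad\text{for every } j>r,$$ and $r$ is the smallest integer $\ge 1$ for which such a recursion (with some coefficients) is available. (3) There are an integer $r\ge1$, numbers $a_1,\dots,a_r\in\mathbb C$, and polynomials $P,Q\in\mathbb C[z]$ with $P(0)\ne0$ such that, for every direction $d\in\mathbb R$ that is not an argument (modulo $2\pi$) of a root of $1-a_1z-\dots-a_rz^r$, the series $\hat f$ is $1$-summable in direction $d$, and its $1$-sum is an actual solution of $P(z^2\partial_z+z)\,y=Q(z)$; here $P$ and $Q$ do not depend on $d$. Here regions lie in the Riemann surface $\mathcal R$ of the logarithm. For $d\in\mathbb R$ and $\theta,\rho>0$, put $S_d(\theta)=\{z\in\mathcal R:|\arg z-d|<\theta\pi/2\}$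 and $S_d(\theta,\rho)=\{z\in S_d(\theta):0<|z|<\rho\}$. A sectorial region bisected by $d$ of opening $\alpha\pi$ is a domain $G\subset S_d(\alpha)$ such that for every $\beta\in(0,\alpha)$ there is $\rho>0$ with $S_d(\beta,\rho)\subset G$. The series $\hat f$ is $1$-summable in direction $d$, with $1$-sum $f$ on $G$, if $G$ is a sectorial region bisected by $d$ of opening $\alpha\pi$ with $\alpha>1$, and $f$ is a holomorphic function on $G$ such that for each bounded sector $T$ with $\overline T\setminus\{0\}\subset G$ there are $C,A>0$ with $$\Big|f(z)-\sum_{p=0}^{N-1}f_pz^p\Big|\le C A^N N!\,|z|^N\qquad(z\in T,\ N\ge0),$$ where $f_0=0$. In (3), every $1$-sum of $\hat f$ in direction $d$, on any such $G$, satisfies the equation on all of $G$. -/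

import Mathlib

namespace RamisSum

noncomputable section

/-! ## Formal side -/

/-- The operator `z² ∂_z + z` on the space of formal power series `ℂ[[z]]`. -/
def formalOp : Module.End ℂ (PowerSeries ℂ) :=
  LinearMap.mulLeft ℂ ((PowerSeries.X : PowerSeries ℂ) ^ 2)
      ∘ₗ (PowerSeries.derivative ℂ).toLinearMap
    + LinearMap.mulLeft ℂ (PowerSeries.X : PowerSeries ℂ)

/-- The formal power series `y` solves `P(z² ∂_z + z) y = Q(z)`. -/
def IsFormalSolution (P Q : Polynomial ℂ) (y : PowerSeries ℂ) : Prop :=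
  (Polynomial.aeval formalOp P) y = (Q : PowerSeries ℂ)

/-- The recursion
`f_j = a_1 j f_{j-1} + a_2 j (j-1) f_{j-2} + ... + a_r j (j-1) ... (j-r+1) f_{j-r}` for all `j > r`.
The entry `a i` with `i : Fin r` is the coefficient `a_{i+1}`. -/
def SatisfiesRecursion (f : PowerSeries ℂ) (r : ℕ) (a : Fin r → ℂ) : Prop :=
  ∀ j : ℕ, r < j →
    PowerSeries.coeff j f =
      ∑ i : Fin r, a i * (j.descFactorial (i + 1) : ℂ) * PowerSeries.coeff (j - (i + 1)) f

/-- The polynomial `1 - a_1 z - ... - a_r z^r`. -/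
def charPoly {r : ℕ} (a : Fin r → ℂ) : Polynomial ℂ :=
  1 - ∑ i : Fin r, Polynomial.C (a i) * Polynomial.X ^ ((i : ℕ) + 1)

/-- `d` is an argument (modulo `2π`) of some nonzero root of `h`. -/
def IsRootDirection (h : Polynomial ℂ) (d : ℝ) : Prop :=
  ∃ x : ℂ, x ≠ 0 ∧ h.IsRoot x ∧ x = (‖x‖ : ℂ) * Complex.exp (d * Complex.I)

/-! ## Analytic side

The Riemann surface of the logarithm is the universal covering `exp : ℂ → ℂ \ {0}`. A point of it
is given by its logarithm `w = log|z| + i arg z`, which is a global holomorphic coordinate, so that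
a holomorphic function on a region of the surface is a holomorphic function of `w`. -/

/-- The Riemann surface of the logarithm, in the global coordinate `w = log z`. -/
abbrev LogSurface : Type := ℂ

/-- The value `z = e^w` in `ℂ \ {0}` of a point of the Riemann surface of the logarithm. -/
def zval (w : LogSurface) : ℂ := Complex.exp w

/-- The argument (a real number, not reduced modulo `2π`) of a point of the surface. -/
def zarg (w : LogSurface) : ℝ := w.im

/-- The bounded sector `S_d(θ, ρ)`: `|arg z - d| < θπ/2` and `0 < |z| < ρ`. -/
def sector (d θ ρ : ℝ) : Set LogSurface :=
  {w | |zarg w - d| < Real.pi * θ / 2 ∧ ‖zval w‖ < ρ}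

/-- The unbounded sector `S_d(θ)`: `|arg z - d| < θπ/2`. -/
def unboundedSector (d θ : ℝ) : Set LogSurface :=
  {w | |zarg w - d| < Real.pi * θ / 2}

/-- `G` is a sectorial region with bisecting direction `d` and opening `απ`: a domain contained in
`S_d(α)` that contains, for each `β ∈ (0, α)`, a bounded sector `S_d(β, ρ)` with `ρ > 0`. -/
structure IsSectorialRegion (G : Set LogSurface) (d α : ℝ) : Prop where
  isOpen : IsOpen G
  isConnected : IsConnected G
  subset : G ⊆ unboundedSector d α
  exists_sector : ∀ β : ℝ, 0 < β → β < α → ∃ ρ : ℝ, 0 < ρ ∧ sector d β ρ ⊆ G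

/-- `F` admits `f = ∑ f_p z^p` as Gevrey asymptotic expansion of order `1` in `G`: on each bounded
proper subsector `T` of `G` one has `|F(z) - ∑_{p<N} f_p z^p| ≤ C A^N N! |z|^N` for all `N`.
The origin is not a point of the surface, so "the closure of `T` without `0` lies in `G`"
is `closure T ⊆ G`. -/
def HasGevreyOneExpansion (F : LogSurface → ℂ) (G : Set LogSurface) (f : PowerSeries ℂ) : Prop :=
  ∀ d' θ' ρ' : ℝ, 0 < θ' → 0 < ρ' → closure (sector d' θ' ρ') ⊆ G →
    ∃ C A : ℝ, 0 < C ∧ 0 < A ∧ ∀ N : ℕ, ∀ w ∈ sector d' θ' ρ',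
      ‖F w - ∑ p ∈ Finset.range N, PowerSeries.coeff p f * zval w ^ p‖
        ≤ C * A ^ N * (N.factorial : ℝ) * ‖zval w‖ ^ N

/-- `F` is a `1`-sum of `f` in direction `d` on `G`: `G` is a sectorial region bisected by `d` of
opening larger than `π`, and `F` is holomorphic on `G` with Gevrey asymptotic expansion `f` of
order `1` there. -/
def IsOneSum (f : PowerSeries ℂ) (d : ℝ) (G : Set LogSurface) (F : LogSurface → ℂ) : Prop :=
  (∃ α : ℝ, 1 < α ∧ IsSectorialRegion G d α) ∧ DifferentiableOn ℂ F G ∧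
    HasGevreyOneExpansion F G f

/-- `f` is `1`-summable in direction `d`. -/
def IsOneSummable (f : PowerSeries ℂ) (d : ℝ) : Prop :=
  ∃ (G : Set LogSurface) (F : LogSurface → ℂ), IsOneSum f d G F

/-- The derivative `∂_z` in the coordinate `w = log z`, where `dz = z dw`. -/
def zderiv (F : LogSurface → ℂ) : LogSurface → ℂ := fun w => (zval w)⁻¹ * deriv F w

/-- The operator `z² ∂_z + z` on functions on the Riemann surface of the logarithm. -/
def actualOp (F : LogSurface → ℂ) : LogSurface → ℂ :=
  fun w => zval w ^ 2 * zderiv F w + zval w * F w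

/-- The function `F` solves `P(z² ∂_z + z) y = Q(z)` at each point of `G`. -/
def IsActualSolution (P Q : Polynomial ℂ) (G : Set LogSurface) (F : LogSurface → ℂ) : Prop :=
  ∀ w ∈ G, P.sum (fun n c => c * (actualOp^[n] F) w) = Q.eval (zval w)

end

end RamisSum

namespace RamisSum

/-! ### The formal Borel transform -/

/-! The formal Borel transform b = ∑ (f_p / p!) ζ^p turns z²∂_z + z into multiplication by ζ. Hence
P(z²∂_z + z) f = Q says exactly that P·b is a given polynomial. Up to the scalar P(0), this is also
what the recursion says: divided by j!, it has constant coefficients and states that (1 - a₁ζ - ...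
- a_rζ^r)·b has no coefficient beyond degree r. So (1) and (2) both mean that b is the expansion at
0 of a rational function without pole at 0; minimality of r is only well-ordering.

For (1) ⇒ (3), b = R/P continues along every direction that meets no root of P, with Taylor
remainders of exponential type in a thin sector (`exists_hasExpExpansion`). A Laplace integral along
a ray turning slowly with arg z then gives a 1-sum on a sector of opening larger than π
(`exists_gevreyOn_of_hasExpExpansion`). Any 1-sum F satisfies the equation: by Cauchy's estimates
the defect P(z²∂_z + z)F - Q has the formal defect, here 0, as Gevrey expansion. A flat function on
an opening larger than π vanishes (`watson`), and the identity theorem carries this over G.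

For (3) ⇒ (1), some direction is not a root direction. There the defect of a 1-sum is identically 0,
and uniqueness of asymptotic expansions (`GevreyOn.eq_zero`) makes the formal defect 0. -/

/-- The formal Borel transform `∑ f_p z^p ↦ ∑ (f_p / p!) z^p`. -/
noncomputable def borel : PowerSeries ℂ →ₗ[ℂ] PowerSeries ℂ where
  toFun f := PowerSeries.mk fun p => PowerSeries.coeff p f / (p.factorial : ℂ)
  map_add' f g := by ext p; simp [add_div]
  map_smul' c f := by ext p; simp [mul_div_assoc]

@[simp] theorem coeff_borel (f : PowerSeries ℂ) (p : ℕ) :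
    PowerSeries.coeff p (borel f) = PowerSeries.coeff p f / (p.factorial : ℂ) := by
  simp [borel]

theorem borel_injective : Function.Injective borel := by
  intro f g h
  ext p
  have := congrArg (PowerSeries.coeff p) h
  simp only [coeff_borel] at this
  exact (div_left_inj' (by exact_mod_cast p.factorial_ne_zero)).1 this

theorem coeff_zero_formalOp (f : PowerSeries ℂ) :
    PowerSeries.coeff 0 (formalOp f) = 0 := by
  simp [formalOp, pow_two]

theorem coeff_succ_formalOp (f : PowerSeries ℂ) (p : ℕ) :
    PowerSeries.coeff (p + 1) (formalOp f) = (p + 1 : ℂ) * PowerSeries.coeff p f := by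
  rcases p with _ | p
  · simp [formalOp, pow_two, PowerSeries.coeff_succ_X_mul]
  · simp [formalOp, pow_two, PowerSeries.coeff_succ_X_mul, PowerSeries.coeff_derivative]
    ring

/-- The operator moves f_p to degree p + 1 with a factor p + 1, and dividing by (p + 1)! instead of
p! cancels that factor. -/
theorem borel_formalOp (f : PowerSeries ℂ) :
    borel (formalOp f) = PowerSeries.X * borel f := by
  ext p
  rcases p with _ | p
  · simp [coeff_zero_formalOp]
  · rw [coeff_borel, coeff_succ_formalOp, PowerSeries.coeff_succ_X_mul, coeff_borel,
      Nat.factorial_succ]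
    have h : (p.factorial : ℂ) ≠ 0 := by exact_mod_cast p.factorial_ne_zero
    have h' : (p + 1 : ℂ) ≠ 0 := by exact_mod_cast p.succ_ne_zero
    push_cast
    field_simp

theorem borel_aeval_formalOp (P : Polynomial ℂ) (f : PowerSeries ℂ) :
    borel (Polynomial.aeval formalOp P f) = (P : PowerSeries ℂ) * borel f := by
  have hpow : ∀ n : ℕ, borel ((formalOp ^ n) f) = PowerSeries.X ^ n * borel f := by
    intro n
    induction n with
    | zero => simp
    | succ n ih => rw [pow_succ', Module.End.mul_apply, borel_formalOp, ih, pow_succ', mul_assoc]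
  induction P using Polynomial.induction_on' with
  | add p q hp hq => simp [hp, hq, add_mul]
  | monomial n c =>
    rw [Polynomial.aeval_monomial, Module.End.mul_apply, Module.algebraMap_end_apply, map_smul,
      hpow, ← Polynomial.C_mul_X_pow_eq_monomial, Polynomial.coe_mul, Polynomial.coe_C,
      Polynomial.coe_pow, Polynomial.coe_X, PowerSeries.smul_eq_C_mul, mul_assoc]

theorem exists_polynomial_of_coeff_eq_zero {g : PowerSeries ℂ} {r : ℕ}
    (h : ∀ j, r < j → PowerSeries.coeff j g = 0) :
    ∃ R : Polynomial ℂ, (R : PowerSeries ℂ) = g := by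
  refine ⟨PowerSeries.trunc (r + 1) g, ?_⟩
  ext j
  rw [Polynomial.coeff_coe, PowerSeries.coeff_trunc]
  split_ifs with hj
  · rfl
  · exact (h j (by omega)).symm

theorem exists_polynomial_borel (Q : Polynomial ℂ) :
    ∃ R : Polynomial ℂ, (R : PowerSeries ℂ) = borel (Q : PowerSeries ℂ) :=
  exists_polynomial_of_coeff_eq_zero (r := Q.natDegree) fun j hj => by
    rw [coeff_borel, Polynomial.coeff_coe, Polynomial.coeff_eq_zero_of_natDegree_lt hj, zero_div]

theorem exists_polynomial_of_borel {g : PowerSeries ℂ} {R : Polynomial ℂ}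
    (h : borel g = (R : PowerSeries ℂ)) : ∃ Q : Polynomial ℂ, (Q : PowerSeries ℂ) = g :=
  exists_polynomial_of_coeff_eq_zero (r := R.natDegree) fun j hj => by
    have := congrArg (PowerSeries.coeff j) h
    rw [coeff_borel, Polynomial.coeff_coe, Polynomial.coeff_eq_zero_of_natDegree_lt hj] at this
    simpa [j.factorial_ne_zero] using this

/-! ### The recursion -/

theorem coeff_charPoly_mul {r : ℕ} (a : Fin r → ℂ) (g : PowerSeries ℂ) (j : ℕ) (hj : r < j) :
    PowerSeries.coeff j ((charPoly a : PowerSeries ℂ) * g) =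
      PowerSeries.coeff j g - ∑ i : Fin r, a i * PowerSeries.coeff (j - (i + 1)) g := by
  have hc : (charPoly a : PowerSeries ℂ) =
      1 - ∑ i : Fin r, PowerSeries.C (a i) * PowerSeries.X ^ ((i : ℕ) + 1) := by
    have := map_sub Polynomial.coeToPowerSeries.ringHom (1 : Polynomial ℂ)
      (∑ i : Fin r, Polynomial.C (a i) * Polynomial.X ^ ((i : ℕ) + 1))
    rw [map_sum, map_one] at this
    simpa [charPoly] using this
  rw [hc, sub_mul, one_mul, map_sub, Finset.sum_mul, map_sum]
  congr 1
  refine Finset.sum_congr rfl fun i _ => ?_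
  rw [mul_assoc, PowerSeries.coeff_C_mul, PowerSeries.coeff_X_pow_mul', if_pos (by omega)]

/-- Since j(j-1)⋯(j-k+1) = j!/(j-k)!, division by j! leaves a recursion with constant coefficients
for f_p / p!. -/
theorem satisfiesRecursion_iff (f : PowerSeries ℂ) {r : ℕ} (a : Fin r → ℂ) :
    SatisfiesRecursion f r a ↔
      ∀ j, r < j → PowerSeries.coeff j ((charPoly a : PowerSeries ℂ) * borel f) = 0 := by
  refine forall₂_congr fun j hj => ?_
  rw [coeff_charPoly_mul a _ j hj, sub_eq_zero, coeff_borel,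
    div_eq_iff (by exact_mod_cast j.factorial_ne_zero), Finset.sum_mul]
  refine Eq.congr_right (Finset.sum_congr rfl fun i _ => ?_)
  have h : (i : ℕ) + 1 ≤ j := by omega
  have hd := Nat.factorial_mul_descFactorial h
  have hf : ((j - (i + 1)).factorial : ℂ) ≠ 0 := by
    exact_mod_cast (j - (i + 1)).factorial_ne_zero
  rw [coeff_borel, ← hd]
  push_cast
  field_simp

theorem eval_zero_charPoly {r : ℕ} (a : Fin r → ℂ) : (charPoly a).eval 0 = 1 := by
  simp [charPoly, Polynomial.eval_finsetSum]

/-- Normalising the constant term keeps the roots; r may exceed the degree, the surplus coefficients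
being 0. -/
theorem exists_charPoly_eq (P : Polynomial ℂ) (hP : P.eval 0 ≠ 0) {r : ℕ}
    (hr : P.natDegree ≤ r) :
    ∃ a : Fin r → ℂ, P = Polynomial.C (P.eval 0) * charPoly a := by
  refine ⟨fun i => -(P.coeff (i + 1) / P.eval 0), ?_⟩
  have h : ∀ i : Fin r, Polynomial.C (P.eval 0) *
      (Polynomial.C (-(P.coeff (i + 1) / P.eval 0)) * Polynomial.X ^ ((i : ℕ) + 1)) =
      -(Polynomial.C (P.coeff (i + 1)) * Polynomial.X ^ ((i : ℕ) + 1)) := by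
    intro i
    rw [← mul_assoc, ← Polynomial.C_mul, mul_neg, mul_div_cancel₀ _ hP, Polynomial.C_neg, neg_mul]
  rw [charPoly, mul_sub, Finset.mul_sum, Finset.sum_congr rfl fun i _ => h i,
    Finset.sum_neg_distrib, sub_neg_eq_add, mul_one,
    Fin.sum_univ_eq_sum_range (fun i => Polynomial.C (P.coeff (i + 1)) * Polynomial.X ^ (i + 1)),
    ← Polynomial.coeff_zero_eq_eval_zero]
  conv_lhs => rw [P.as_sum_range_C_mul_X_pow' (show P.natDegree < r + 1 by omega)]
  rw [Finset.sum_range_succ', add_comm]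
  simp

theorem isFormalSolution_iff (P Q : Polynomial ℂ) (f : PowerSeries ℂ) :
    IsFormalSolution P Q f ↔ (P : PowerSeries ℂ) * borel f = borel (Q : PowerSeries ℂ) := by
  rw [IsFormalSolution, ← borel_aeval_formalOp, borel_injective.eq_iff]

theorem exists_formalSolution_of_recursion {f : PowerSeries ℂ} {r : ℕ} {a : Fin r → ℂ}
    (h : SatisfiesRecursion f r a) :
    ∃ P Q : Polynomial ℂ, P.eval 0 ≠ 0 ∧ IsFormalSolution P Q f := by
  obtain ⟨R, hR⟩ := exists_polynomial_of_coeff_eq_zero ((satisfiesRecursion_iff f a).1 h)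
  rw [← borel_aeval_formalOp] at hR
  obtain ⟨Q, hQ⟩ := exists_polynomial_of_borel hR.symm
  exact ⟨charPoly a, Q, by simp [eval_zero_charPoly], hQ.symm⟩

theorem exists_recursion_of_formalSolution {f : PowerSeries ℂ} {P Q : Polynomial ℂ}
    (hP : P.eval 0 ≠ 0) (h : IsFormalSolution P Q f) :
    ∃ (r : ℕ) (a : Fin r → ℂ), 1 ≤ r ∧ SatisfiesRecursion f r a := by
  obtain ⟨R, hR⟩ := exists_polynomial_borel Q
  -- The order must also exceed the degree of R, so that the right-hand side has no coefficient left
  -- where the recursion is required; the 1 ensures r ≥ 1.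
  obtain ⟨a, ha⟩ := exists_charPoly_eq P hP
    (r := P.natDegree + R.natDegree + 1) (by omega)
  refine ⟨_, a, by omega, (satisfiesRecursion_iff f a).2 fun j hj => ?_⟩
  rw [isFormalSolution_iff, ← hR, ha, Polynomial.coe_mul, Polynomial.coe_C, mul_assoc] at h
  have := congrArg (PowerSeries.coeff j) h
  rw [PowerSeries.coeff_C_mul, Polynomial.coeff_coe,
    Polynomial.coeff_eq_zero_of_natDegree_lt (by omega)] at this
  exact (mul_eq_zero.1 this).resolve_left hP

section

open Filter Topology Complex

/-! ### Gevrey estimates on sectors -/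

/-- The Gevrey estimate of order `1` on the set `T` itself. -/
def GevreyOn (F : LogSurface → ℂ) (T : Set LogSurface) (f : PowerSeries ℂ) : Prop :=
  ∃ C A : ℝ, 0 < C ∧ 0 < A ∧ ∀ N : ℕ, ∀ w ∈ T,
    ‖F w - ∑ p ∈ Finset.range N, PowerSeries.coeff p f * zval w ^ p‖
      ≤ C * A ^ N * (N.factorial : ℝ) * ‖zval w‖ ^ N

theorem zval_norm (w : LogSurface) : ‖zval w‖ = Real.exp w.re := Complex.norm_exp w

theorem zval_norm_pos (w : LogSurface) : 0 < ‖zval w‖ := by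
  rw [zval_norm]; exact Real.exp_pos _

theorem hasDerivAt_zval (w : LogSurface) : HasDerivAt zval (zval w) w := Complex.hasDerivAt_exp w

theorem GevreyOn.add {F₁ F₂ : LogSurface → ℂ} {T : Set LogSurface} {f₁ f₂ : PowerSeries ℂ}
    (h₁ : GevreyOn F₁ T f₁) (h₂ : GevreyOn F₂ T f₂) :
    GevreyOn (fun w => F₁ w + F₂ w) T (f₁ + f₂) := by
  obtain ⟨C₁, A₁, hC₁, hA₁, h₁⟩ := h₁
  obtain ⟨C₂, A₂, hC₂, hA₂, h₂⟩ := h₂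
  refine ⟨C₁ + C₂, max A₁ A₂, by positivity, lt_max_of_lt_left hA₁, fun N w hw => ?_⟩
  have e : F₁ w + F₂ w - ∑ p ∈ Finset.range N, PowerSeries.coeff p (f₁ + f₂) * zval w ^ p =
      (F₁ w - ∑ p ∈ Finset.range N, PowerSeries.coeff p f₁ * zval w ^ p) +
      (F₂ w - ∑ p ∈ Finset.range N, PowerSeries.coeff p f₂ * zval w ^ p) := by
    simp only [map_add, add_mul, Finset.sum_add_distrib]; ring
  rw [e, add_mul, add_mul, add_mul]
  refine (norm_add_le _ _).trans (add_le_add ((h₁ N w hw).trans ?_) ((h₂ N w hw).trans ?_))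
  · gcongr; exact le_max_left _ _
  · gcongr; exact le_max_right _ _

theorem GevreyOn.const_mul {F : LogSurface → ℂ} {T : Set LogSurface} {f : PowerSeries ℂ}
    (h : GevreyOn F T f) (c : ℂ) : GevreyOn (fun w => c * F w) T (c • f) := by
  obtain ⟨C, A, hC, hA, h⟩ := h
  refine ⟨(‖c‖ + 1) * C, A, by positivity, hA, fun N w hw => ?_⟩
  have e : c * F w - ∑ p ∈ Finset.range N, PowerSeries.coeff p (c • f) * zval w ^ p =
      c * (F w - ∑ p ∈ Finset.range N, PowerSeries.coeff p f * zval w ^ p) := by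
    simp only [mul_sub, Finset.mul_sum, map_smul, smul_eq_mul, mul_assoc]
  rw [e, norm_mul, mul_assoc, mul_assoc, mul_assoc]
  refine mul_le_mul (by linarith) ?_ (norm_nonneg _) (by positivity)
  simpa only [mul_assoc] using h N w hw

theorem gevreyOn_polynomial (Q : Polynomial ℂ) (d β ρ : ℝ) :
    GevreyOn (fun w => Q.eval (zval w)) (sector d β ρ) (Q : PowerSeries ℂ) := by
  induction Q using Polynomial.induction_on' with
  | add p q hp hq => simpa using hp.add hq
  | monomial n c =>
    refine ⟨(‖c‖ + 1) * max 1 ρ ^ n, 1, by positivity, one_pos, fun N w hw => ?_⟩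
    have hz : ‖zval w‖ ≤ max 1 ρ := hw.2.le.trans (le_max_right _ _)
    have h1 : (1 : ℝ) ≤ N.factorial := by exact_mod_cast N.factorial_pos
    simp only [Polynomial.eval_monomial, Polynomial.coeff_coe, Polynomial.coeff_monomial, ite_mul,
      zero_mul, Finset.sum_ite_eq, Finset.mem_range]
    split_ifs with hn
    · rw [sub_self, norm_zero]; positivity
    · rw [sub_zero, norm_mul, norm_pow, one_pow, mul_one]
      obtain ⟨k, rfl⟩ := Nat.exists_eq_add_of_le (not_lt.1 hn)
      calc ‖c‖ * ‖zval w‖ ^ (N + k) = ‖c‖ * ‖zval w‖ ^ k * 1 * ‖zval w‖ ^ N := by ring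
        _ ≤ (‖c‖ + 1) * max 1 ρ ^ (N + k) * N.factorial * ‖zval w‖ ^ N := by
          gcongr
          · linarith
          · exact (pow_le_pow_left₀ (norm_nonneg _) hz k).trans
              (pow_le_pow_right₀ (le_max_left _ _) (by omega))

theorem GevreyOn.eq_zero {d β ρ : ℝ} (hβ : 0 < β) (hρ : 0 < ρ) {g : PowerSeries ℂ}
    (h : GevreyOn (fun _ => 0) (sector d β ρ) g) : g = 0 := by
  obtain ⟨C, A, hC, hA, h⟩ := h
  ext N
  induction N using Nat.strong_induction_on with
  | _ N ih =>
    rw [map_zero]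
    by_contra hN
    have hN' := norm_pos_iff.2 hN
    set K := C * A ^ (N + 1) * ((N + 1).factorial : ℝ) with hK
    have hKpos : 0 < K := by positivity
    -- At a point of modulus x on the bisecting ray, the estimate of order N + 1 would bound the
    -- first nonzero coefficient by K x, at most half its modulus.
    set x := min ρ (‖PowerSeries.coeff N g‖ / K) / 2 with hx
    have hm : 0 < min ρ (‖PowerSeries.coeff N g‖ / K) := lt_min hρ (by positivity)
    have hxpos : 0 < x := by positivity
    have hw : ‖zval ((Real.log x : ℂ) + d * I)‖ = x := by
      rw [zval_norm]; simp [Real.exp_log hxpos]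
    have hmem : ((Real.log x : ℂ) + d * I) ∈ sector d β ρ := by
      refine ⟨?_, ?_⟩
      · simp [zarg]; positivity
      · rw [hw]; linarith [min_le_left ρ (‖PowerSeries.coeff N g‖ / K)]
    have := h (N + 1) _ hmem
    rw [Finset.sum_range_succ, Finset.sum_eq_zero (fun p hp => by
      rw [ih p (Finset.mem_range.1 hp), map_zero, zero_mul]), zero_add, zero_sub, norm_neg,
      norm_mul, norm_pow, hw, ← hK, pow_succ', ← mul_assoc] at this
    have h2 := le_of_mul_le_mul_right this (by positivity)
    have h3 : K * x < ‖PowerSeries.coeff N g‖ := by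
      rw [mul_comm, ← lt_div_iff₀ hKpos]
      linarith [min_le_right ρ (‖PowerSeries.coeff N g‖ / K)]
    linarith

theorem sector_isOpen (d β ρ : ℝ) : IsOpen (sector d β ρ) := by
  have h1 : IsOpen {w : ℂ | |w.im - d| < Real.pi * β / 2} :=
    isOpen_lt (Complex.continuous_im.sub continuous_const).abs continuous_const
  have h2 : IsOpen {w : ℂ | ‖Complex.exp w‖ < ρ} :=
    isOpen_lt Complex.continuous_exp.norm continuous_const
  exact h1.inter h2

/-- In the coordinate log z one radius ε serves all points up to the origin; in z this is a disc of
size proportional to |z|, as Cauchy's estimate needs. -/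
theorem closedBall_subset_sector {d β β₁ ρ ρ₁ ε : ℝ} (h1 : ε ≤ Real.pi * (β₁ - β) / 2)
    (h2 : Real.exp ε * ρ ≤ ρ₁) {w : LogSurface} (hw : w ∈ sector d β ρ) :
    Metric.closedBall w ε ⊆ sector d β₁ ρ₁ := by
  intro v hv
  rw [Metric.mem_closedBall, dist_eq_norm] at hv
  obtain ⟨ha, hb⟩ := hw
  rw [zval_norm] at hb
  refine ⟨?_, ?_⟩
  · have e : zarg v - d = (zarg w - d) + (v - w).im := by simp [zarg]
    have := (Complex.abs_im_le_norm (v - w)).trans hv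
    rw [e]
    calc _ ≤ |zarg w - d| + |(v - w).im| := abs_add_le _ _
      _ < Real.pi * β / 2 + ε := by linarith
      _ ≤ _ := by linarith
  · have := (le_abs_self _).trans ((Complex.abs_re_le_norm (v - w)).trans hv)
    rw [Complex.sub_re] at this
    rw [zval_norm]
    calc Real.exp v.re ≤ Real.exp (ε + w.re) := Real.exp_le_exp.2 (by linarith)
      _ = Real.exp ε * Real.exp w.re := Real.exp_add _ _
      _ < Real.exp ε * ρ := by gcongr
      _ ≤ ρ₁ := h2

theorem actualOp_apply (F : LogSurface → ℂ) (w : LogSurface) :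
    actualOp F w = zval w * (deriv F w + F w) := by
  have : zval w ≠ 0 := norm_pos_iff.1 (zval_norm_pos w)
  rw [actualOp, zderiv]; field_simp

theorem actualOp_sub_sum {F : LogSurface → ℂ} {w : LogSurface} (hF : DifferentiableAt ℂ F w)
    (f : PowerSeries ℂ) (N : ℕ) :
    actualOp F w - ∑ p ∈ Finset.range (N + 1), PowerSeries.coeff p (formalOp f) * zval w ^ p =
      zval w * (deriv (fun v => F v - ∑ p ∈ Finset.range N, PowerSeries.coeff p f * zval v ^ p) w
        + (F w - ∑ p ∈ Finset.range N, PowerSeries.coeff p f * zval w ^ p)) := by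
  have hs : HasDerivAt (fun v => ∑ p ∈ Finset.range N, PowerSeries.coeff p f * zval v ^ p)
      (∑ p ∈ Finset.range N, PowerSeries.coeff p f * (p * zval w ^ p)) w := by
    refine HasDerivAt.fun_sum fun p _ => ?_
    refine (((hasDerivAt_zval w).fun_pow p).const_mul _).congr_deriv ?_
    rcases p with _ | p
    · simp
    · rw [Nat.add_sub_cancel, pow_succ, mul_assoc]
  rw [(hF.hasDerivAt.fun_sub hs).deriv, actualOp_apply, Finset.sum_range_succ', coeff_zero_formalOp,
    zero_mul, add_zero, Finset.sum_congr rfl fun p _ => by rw [coeff_succ_formalOp]]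
  have e : ∑ p ∈ Finset.range N, (p + 1 : ℂ) * PowerSeries.coeff p f * zval w ^ (p + 1) =
      zval w * (∑ p ∈ Finset.range N, PowerSeries.coeff p f * (p * zval w ^ p) +
        ∑ p ∈ Finset.range N, PowerSeries.coeff p f * zval w ^ p) := by
    rw [← Finset.sum_add_distrib, Finset.mul_sum]
    exact Finset.sum_congr rfl fun p _ => by ring
  rw [e]; ring

/-- With w = log z the operator is z(d/dw + 1), so it sends the N-th remainder of F to the (N+1)-st
remainder of the image. On the ε-disc |z| grows at most by e^ε, so Cauchy's estimate only replaces A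
by A e^ε. -/
theorem GevreyOn.actualOp {F : LogSurface → ℂ} {f : PowerSeries ℂ} {d β β₁ ρ ρ₁ : ℝ}
    (h : GevreyOn F (sector d β₁ ρ₁) f) (hF : DifferentiableOn ℂ F (sector d β₁ ρ₁))
    (hβ : β < β₁) (hρ0 : 0 < ρ) (hρ : ρ < ρ₁) :
    GevreyOn (actualOp F) (sector d β ρ) (formalOp f) := by
  obtain ⟨C, A, hC, hA, h⟩ := h
  obtain ⟨ε, hε, hε1, hε2⟩ :
      ∃ ε : ℝ, 0 < ε ∧ ε ≤ Real.pi * (β₁ - β) / 2 ∧ Real.exp ε * ρ ≤ ρ₁ := by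
    refine ⟨min (Real.pi * (β₁ - β) / 2) (Real.log (ρ₁ / ρ)), lt_min ?_ ?_, min_le_left _ _, ?_⟩
    · have := sub_pos.2 hβ; positivity
    · exact Real.log_pos ((one_lt_div hρ0).2 hρ)
    · rw [← le_div_iff₀ hρ0]
      exact (Real.exp_le_exp.2 (min_le_right _ _)).trans
        (Real.exp_log (div_pos (hρ0.trans hρ) hρ0)).le
  set K := C * (1 / ε + 1) with hK
  set B := A * Real.exp ε with hB
  have hKpos : 0 < K := by positivity
  have hBpos : 0 < B := by positivity
  have main : ∀ N : ℕ, ∀ w ∈ sector d β ρ,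
      ‖RamisSum.actualOp F w -
        ∑ p ∈ Finset.range (N + 1), PowerSeries.coeff p (formalOp f) * zval w ^ p‖
      ≤ K * B ^ N * (N.factorial : ℝ) * ‖zval w‖ ^ (N + 1) := by
    intro N w hw
    have hsub := closedBall_subset_sector hε1 hε2 hw
    have hw₁ : w ∈ sector d β₁ ρ₁ := hsub (Metric.mem_closedBall_self hε.le)
    have hFw := hF.differentiableAt ((sector_isOpen d β₁ ρ₁).mem_nhds hw₁)
    rw [actualOp_sub_sum hFw, norm_mul]
    set R := fun v => F v - ∑ p ∈ Finset.range N, PowerSeries.coeff p f * zval v ^ p with hR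
    have hbound : ∀ v ∈ Metric.closedBall w ε,
        ‖R v‖ ≤ C * B ^ N * (N.factorial : ℝ) * ‖zval w‖ ^ N := by
      intro v hv
      refine (h N v (hsub hv)).trans ?_
      rw [Metric.mem_closedBall, dist_eq_norm] at hv
      have h1 := (le_abs_self _).trans ((Complex.abs_re_le_norm (v - w)).trans hv)
      rw [Complex.sub_re] at h1
      have h2 : ‖zval v‖ ≤ Real.exp ε * ‖zval w‖ := by
        rw [zval_norm, zval_norm, ← Real.exp_add]
        exact Real.exp_le_exp.2 (by linarith)
      calc C * A ^ N * (N.factorial : ℝ) * ‖zval v‖ ^ N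
          ≤ C * A ^ N * (N.factorial : ℝ) * (Real.exp ε * ‖zval w‖) ^ N := by gcongr
        _ = _ := by rw [hB]; ring
    have hd : DifferentiableOn ℂ R (sector d β₁ ρ₁) := by
      refine hF.sub (Differentiable.differentiableOn ?_)
      refine Differentiable.fun_sum fun p _ => ?_
      exact fun v => ((hasDerivAt_zval v).differentiableAt.fun_pow p).const_mul _
    have hderiv := Complex.norm_deriv_le_of_forall_mem_sphere_norm_le hε
      (hd.mono (Metric.closure_ball_subset_closedBall.trans hsub)).diffContOnCl
      (fun v hv => hbound v (Metric.sphere_subset_closedBall hv))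
    have hself := hbound w (Metric.mem_closedBall_self hε.le)
    calc ‖zval w‖ * ‖deriv R w + R w‖
        ≤ ‖zval w‖ * (C * B ^ N * (N.factorial : ℝ) * ‖zval w‖ ^ N / ε +
            C * B ^ N * (N.factorial : ℝ) * ‖zval w‖ ^ N) := by
          gcongr; exact (norm_add_le _ _).trans (add_le_add hderiv hself)
      _ = _ := by rw [hK]; ring
  -- `K / B` absorbs the index shift from N to N + 1; `K * ρ` covers N = 0, which `main` does not
  -- reach directly.
  refine ⟨K / B + K * ρ, B, by positivity, hBpos, fun N w hw => ?_⟩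
  rcases N with _ | N
  · have := main 0 w hw
    simp only [zero_add, Finset.range_one, Finset.sum_singleton, coeff_zero_formalOp,
      pow_zero, pow_one, Nat.factorial_zero, Nat.cast_one, mul_one, Finset.range_zero,
      Finset.sum_empty] at this ⊢
    have h1 : K * ‖zval w‖ ≤ K * ρ := by gcongr; exact hw.2.le
    have : 0 < K / B := by positivity
    linarith
  · refine (main N w hw).trans ?_
    have h1 : (N.factorial : ℝ) ≤ (N + 1).factorial := by
      exact_mod_cast Nat.factorial_le N.le_succ
    calc K * B ^ N * (N.factorial : ℝ) * ‖zval w‖ ^ (N + 1)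
        ≤ K * B ^ N * ((N + 1).factorial : ℝ) * ‖zval w‖ ^ (N + 1) := by gcongr
      _ = (K / B) * B ^ (N + 1) * ((N + 1).factorial : ℝ) * ‖zval w‖ ^ (N + 1) := by
          field_simp; ring
      _ ≤ _ := by
          gcongr
          linarith [mul_pos hKpos hρ0]

/-! ### Watson's lemma -/

/-- Instead of choosing the best N, all inequalities are summed with weights (1/(2Ax))^N / N!: the
left side becomes an exponential series, the right side a geometric series of ratio 1/2. -/
theorem norm_le_exp_of_gevrey {x C A y : ℝ} (hA : 0 < A) (hx : 0 < x)
    (h : ∀ N : ℕ, y ≤ C * A ^ N * (N.factorial : ℝ) * x ^ N) :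
    y ≤ 2 * C * Real.exp (-(1 / (2 * A * x))) := by
  have h1 : HasSum (fun N : ℕ => y * ((1 / (2 * A * x)) ^ N / (N.factorial : ℝ)))
      (y * Real.exp (1 / (2 * A * x))) := by
    have := NormedSpace.expSeries_div_hasSum_exp (𝔸 := ℝ) (1 / (2 * A * x))
    rw [← Real.exp_eq_exp_ℝ] at this
    exact this.mul_left y
  have h2 : HasSum (fun N : ℕ => C * (1 / 2) ^ N) (C * 2) := hasSum_geometric_two.mul_left C
  have h3 := hasSum_le (fun N => ?_) h1 h2
  · rw [Real.exp_neg, ← div_eq_mul_inv, le_div_iff₀ (Real.exp_pos _)]; linarith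
  · have hf : (0 : ℝ) < N.factorial := by exact_mod_cast N.factorial_pos
    calc y * ((1 / (2 * A * x)) ^ N / (N.factorial : ℝ))
        ≤ (C * A ^ N * (N.factorial : ℝ) * x ^ N) *
          ((1 / (2 * A * x)) ^ N / (N.factorial : ℝ)) := by gcongr; exact h N
      _ = C * (1 / 2) ^ N := by
          rw [div_pow, div_pow, mul_pow, mul_pow]; field_simp

theorem superpolynomialDecay_exp_neg_rpow {K κ M γ : ℝ} (hκ : 0 < κ) (hM : 0 < M) (hγ : 1 < γ)
    {g : ℝ → ℝ} (hg0 : ∀ x, 0 ≤ g x) (hg : ∀ x, 0 ≤ x → g x ≤ K * Real.exp (-κ * (x + M) ^ γ)) :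
    Asymptotics.SuperpolynomialDecay atTop Real.exp g := by
  intro n
  have hK : 0 ≤ K := by
    have := (hg0 0).trans (hg 0 le_rfl)
    exact nonneg_of_mul_nonneg_left this (Real.exp_pos _)
  have ht : Tendsto (fun x : ℝ => K * Real.exp (-(x * (κ * x ^ (γ - 1) - n)))) atTop (𝓝 0) := by
    rw [show (0 : ℝ) = K * 0 by simp]
    refine Tendsto.const_mul K (Real.tendsto_exp_neg_atTop_nhds_zero.comp ?_)
    refine tendsto_id.atTop_mul_atTop₀ (tendsto_atTop_add_const_right _ _ ?_)
    exact (tendsto_rpow_atTop (sub_pos.2 hγ)).const_mul_atTop hκ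
  refine squeeze_zero' (Eventually.of_forall fun x => by have := hg0 x; positivity) ?_ ht
  filter_upwards [eventually_gt_atTop 0] with x hx
  calc Real.exp x ^ n * g x ≤ Real.exp x ^ n * (K * Real.exp (-κ * (x + M) ^ γ)) := by
        gcongr; exact hg x hx.le
    _ ≤ Real.exp x ^ n * (K * Real.exp (-κ * x ^ γ)) := by
        have : x ^ γ ≤ (x + M) ^ γ := Real.rpow_le_rpow hx.le (by linarith) (by linarith)
        have : Real.exp (-κ * (x + M) ^ γ) ≤ Real.exp (-κ * x ^ γ) :=
          Real.exp_le_exp.2 (by nlinarith)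
        gcongr
    _ = K * (Real.exp (n * x) * Real.exp (-κ * x ^ γ)) := by rw [Real.exp_nat_mul]; ring
    _ = _ := by
        rw [← Real.exp_add]
        congr 2
        rw [Real.rpow_sub_one hx.ne']
        field_simp; ring

/-- For 1 < γ < β, z = e^{id}(v + M)^{-γ} maps the right half-plane into the sector. The bound
exp(-c/|z|) becomes exp(-c|v + M|^γ), superexponential decay on the real axis, so a
Phragmén–Lindelöf theorem applies. Vanishing near one point suffices for the identity theorem. -/
theorem watson {H : LogSurface → ℂ} {d β ρ : ℝ} (hβ : 1 < β) (hρ : 0 < ρ)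
    (hd : DifferentiableOn ℂ H (sector d β ρ)) (hH : GevreyOn H (sector d β ρ) 0) :
    ∃ w₀ ∈ sector d β ρ, H =ᶠ[𝓝 w₀] 0 := by
  obtain ⟨C, A, hC, hA, hH⟩ := hH
  have hexp : ∀ w ∈ sector d β ρ, ‖H w‖ ≤ 2 * C * Real.exp (-(1 / (2 * A * ‖zval w‖))) :=
    fun w hw => norm_le_exp_of_gevrey hA (zval_norm_pos w) fun N => by simpa using hH N w hw
  obtain ⟨γ, hγ1, hγβ⟩ := exists_between hβ
  have hγ0 : 0 < γ := by linarith
  -- M exceeds 1 and 1/ρ, so M^{-γ} ≤ 1/M < ρ and the image stays below radius ρ.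
  set M := max 1 (1 / ρ) + 1 with hMdef
  have hM1 : 1 < M := by linarith [le_max_left 1 (1 / ρ)]
  have hM0 : 0 < M := by linarith
  have hMρ : M ^ (-γ) < ρ := by
    have h1 : M ^ (-γ) ≤ M ^ (-1 : ℝ) := Real.rpow_le_rpow_of_exponent_le hM1.le (by linarith)
    rw [Real.rpow_neg_one] at h1
    refine h1.trans_lt ?_
    rw [inv_lt_comm₀ hM0 hρ, ← one_div]
    linarith [le_max_right 1 (1 / ρ)]
  set φ : ℂ → ℂ := fun v => d * I - γ * Complex.log (v + M) with hφ
  have hre : ∀ v : ℂ, 0 ≤ v.re → 0 < (v + M).re := fun v hv => by simp; linarith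
  have hnorm : ∀ v : ℂ, 0 ≤ v.re → ‖zval (φ v)‖ = ‖v + M‖ ^ (-γ) := by
    intro v hv
    have : v + M ≠ 0 := fun h => by have := hre v hv; rw [h] at this; simp at this
    rw [zval_norm, Real.rpow_def_of_pos (norm_pos_iff.2 this), hφ]
    congr 1
    simp [Complex.log_re]; ring
  have hmem : ∀ v : ℂ, 0 ≤ v.re → φ v ∈ sector d β ρ := by
    intro v hv
    refine ⟨?_, ?_⟩
    · have h1 := Complex.abs_arg_lt_pi_div_two_iff.2 (Or.inl (hre v hv))
      have e : zarg (φ v) - d = -(γ * (v + M).arg) := by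
        simp [zarg, hφ, Complex.log_im]
      rw [e, abs_neg, abs_mul, abs_of_pos hγ0]
      calc γ * |(v + M).arg| < γ * (Real.pi / 2) := by gcongr
        _ ≤ β * (Real.pi / 2) := by gcongr
        _ = _ := by ring
    · rw [hnorm v hv]
      refine lt_of_le_of_lt ?_ hMρ
      refine Real.rpow_le_rpow_of_nonpos hM0 ?_ (by linarith)
      refine le_trans ?_ (Complex.re_le_norm _)
      simp [hv]
  have hφd : ∀ v : ℂ, 0 ≤ v.re → DifferentiableAt ℂ φ v := by
    intro v hv
    have h1 : DifferentiableAt ℂ (fun v : ℂ => Complex.log (v + M)) v :=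
      (differentiableAt_id.add_const _).clog (Or.inl (hre v hv))
    exact (h1.const_mul _).const_sub _
  have hbd : ∀ v : ℂ, 0 ≤ v.re → ‖H (φ v)‖ ≤ 2 * C := fun v hv => by
    refine (hexp _ (hmem v hv)).trans (mul_le_of_le_one_right (by positivity) ?_)
    rw [Real.exp_le_one_iff, neg_nonpos]; positivity
  have hzero : Set.EqOn (fun v => H (φ v)) 0 {v : ℂ | 0 ≤ v.re} := by
    refine PhragmenLindelof.eq_zero_on_right_half_plane_of_superexponential_decay ?_ ?_ ?_ ?_
    · refine DifferentiableOn.diffContOnCl fun v hv => ?_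
      rw [Complex.closure_setOfPred_lt_re] at hv
      have h1 := hd.differentiableAt ((sector_isOpen d β ρ).mem_nhds (hmem v hv))
      exact (h1.comp v (hφd v hv)).differentiableWithinAt
    · refine ⟨1, by norm_num, 0, Asymptotics.IsBigO.of_bound (2 * C) ?_⟩
      refine eventually_inf_principal.2 (Eventually.of_forall fun v hv => ?_)
      simpa using hbd v (le_of_lt hv)
    · refine superpolynomialDecay_exp_neg_rpow (K := 2 * C) (κ := 1 / (2 * A)) (M := M) (γ := γ)
        (by positivity) hM0 hγ1 (fun _ => norm_nonneg _) fun x hx => ?_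
      refine (hexp _ (hmem x (by simpa using hx))).trans (le_of_eq ?_)
      rw [hnorm x (by simpa using hx), ← Complex.ofReal_add, Complex.norm_real,
        Real.norm_of_nonneg (by linarith), Real.rpow_neg (by linarith)]
      congr 2
      have : (x + M) ^ γ ≠ 0 := (Real.rpow_pos_of_pos (by linarith) _).ne'
      field_simp
    · exact ⟨2 * C, fun x => hbd _ (by simp)⟩
  refine ⟨φ 1, hmem 1 (by simp), ?_⟩
  -- ψ recovers log(v + M) from w = φ(v). The three open conditions below keep it in the principal
  -- strip and v in the half-plane, so a whole neighbourhood of φ(1) lies in the image.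
  set ψ : ℂ → ℂ := fun w => (d * I - w) / γ with hψ
  have hγC : (γ : ℂ) ≠ 0 := by exact_mod_cast hγ0.ne'
  have hψφ : ψ (φ 1) = Complex.log (1 + M) := by
    simp only [hψ, hφ]; field_simp; ring
  have h1M : (1 + M : ℂ) = ((1 + M : ℝ) : ℂ) := by push_cast; ring
  have hψc : Continuous ψ := (continuous_const.sub continuous_id).div_const _
  have hlogim : (Complex.log (1 + M)).im = 0 := by
    rw [h1M, ← Complex.ofReal_log (by linarith), Complex.ofReal_im]
  have e1 : ∀ᶠ w in 𝓝 (φ 1), (ψ w).im < Real.pi :=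
    (Complex.continuous_im.comp hψc).continuousAt.eventually_lt continuousAt_const (by
      simp only [Function.comp_apply, hψφ, hlogim, Real.pi_pos])
  have e2 : ∀ᶠ w in 𝓝 (φ 1), -Real.pi < (ψ w).im :=
    continuousAt_const.eventually_lt (Complex.continuous_im.comp hψc).continuousAt (by
      simp only [hψφ, hlogim, Left.neg_neg_iff, Real.pi_pos])
  have e3 : ∀ᶠ w in 𝓝 (φ 1), 0 < (Complex.exp (ψ w) - M).re :=
    continuousAt_const.eventually_lt
      (Complex.continuous_re.comp ((Complex.continuous_exp.comp hψc).sub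
        continuous_const)).continuousAt (by
      have : (1 + M : ℂ) ≠ 0 := by rw [h1M]; exact_mod_cast (by linarith : (1 + M : ℝ) ≠ 0)
      simp [hψφ, Complex.exp_log this])
  filter_upwards [e1, e2, e3] with w h1 h2 h3
  have := hzero (show Complex.exp (ψ w) - M ∈ {v : ℂ | 0 ≤ v.re} from h3.le)
  simp only [hφ, sub_add_cancel, Complex.log_exp h2 h1.le] at this
  have e : (d * I - γ * ψ w : ℂ) = w := by
    simp only [hψ]; field_simp; ring
  rwa [e] at this

open MeasureTheory Set

/-! ### Integrals on the half-line -/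

theorem integral_pow_mul_exp_neg_mul_Ioi (n : ℕ) {a : ℝ} (ha : 0 < a) :
    ∫ t in Ioi (0 : ℝ), t ^ n * Real.exp (-(a * t)) = n.factorial / a ^ (n + 1) := by
  have h := Real.integral_rpow_mul_exp_neg_mul_Ioi (a := n + 1) (by positivity) ha
  simp only [add_sub_cancel_right, Real.rpow_natCast, Real.Gamma_nat_eq_factorial] at h
  rw [h, ← Nat.cast_succ, Real.rpow_natCast, div_pow, one_pow, one_div_mul_eq_div]

theorem integrableOn_pow_mul_exp_neg_mul_Ioi (n : ℕ) {a : ℝ} (ha : 0 < a) :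
    IntegrableOn (fun t : ℝ => t ^ n * Real.exp (-(a * t))) (Ioi 0) := by
  -- The integral of a non-integrable function is 0 by convention, so the nonzero value proves
  -- integrability.
  refine .of_integral_ne_zero ?_
  rw [integral_pow_mul_exp_neg_mul_Ioi n ha]
  have := n.factorial_pos
  positivity

theorem integrableOn_pow_mul_cexp_neg_mul_Ioi (n : ℕ) {c : ℂ} (hc : 0 < c.re) :
    IntegrableOn (fun t : ℝ => (t : ℂ) ^ n * exp (-(c * t))) (Ioi 0) := by
  refine (integrableOn_pow_mul_exp_neg_mul_Ioi n hc).mono' ?_ ?_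
  · exact Continuous.aestronglyMeasurable (by fun_prop)
  · filter_upwards [ae_restrict_mem measurableSet_Ioi] with t ht
    rw [norm_mul, norm_pow, norm_real, Real.norm_of_nonneg (le_of_lt ht), norm_exp]
    simp

theorem integral_pow_mul_cexp_neg_mul_Ioi (n : ℕ) {c : ℂ} (hc : 0 < c.re) :
    ∫ t in Ioi (0 : ℝ), (t : ℂ) ^ n * exp (-(c * t)) = n.factorial / c ^ (n + 1) := by
  have hc0 : c ≠ 0 := fun h => by simp [h] at hc
  induction n with
  | zero =>
    have := integral_exp_mul_complex_Ioi (a := -c) (by simpa using hc) 0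
    simp only [neg_mul] at this
    simp [this]
  | succ n ih =>
    have hi1 := integrableOn_pow_mul_cexp_neg_mul_Ioi n hc
    have hi2 := integrableOn_pow_mul_cexp_neg_mul_Ioi (n + 1) hc
    have hd : ∀ t ∈ Ioi (0 : ℝ), HasDerivAt (fun t : ℝ => -((t : ℂ) ^ (n + 1) * exp (-(c * t))))
        (c * ((t : ℂ) ^ (n + 1) * exp (-(c * t))) -
          (n + 1) * ((t : ℂ) ^ n * exp (-(c * t)))) t := by
      intro t _
      have h1 : HasDerivAt (fun z : ℂ => -(z ^ (n + 1) * exp (-(c * z))))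
          (-(((n + 1 : ℕ) : ℂ) * (t : ℂ) ^ n * exp (-(c * t)) +
            (t : ℂ) ^ (n + 1) * (exp (-(c * t)) * -(c * 1)))) (t : ℂ) :=
        ((hasDerivAt_pow (n + 1) (t : ℂ)).fun_mul
          (((hasDerivAt_id (t : ℂ)).const_mul c).fun_neg.cexp)).fun_neg
      refine h1.comp_ofReal.congr_deriv ?_
      push_cast; ring
    have hlim : Tendsto (fun t : ℝ => -((t : ℂ) ^ (n + 1) * exp (-(c * t)))) atTop (𝓝 0) := by
      rw [tendsto_zero_iff_norm_tendsto_zero]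
      have h2 := tendsto_rpow_mul_exp_neg_mul_atTop_nhds_zero (n + 1 : ℕ) c.re hc
      refine h2.congr' ?_
      filter_upwards [eventually_gt_atTop 0] with t ht
      rw [Real.rpow_natCast, norm_neg, norm_mul, norm_pow, norm_real, Real.norm_of_nonneg ht.le,
        norm_exp]
      simp
    have key := integral_Ioi_of_hasDerivAt_of_tendsto
      (Continuous.continuousWithinAt (by fun_prop)) hd
      ((hi2.const_mul c).sub (hi1.const_mul (n + 1 : ℂ))) hlim
    rw [integral_sub (hi2.const_mul c) (hi1.const_mul (n + 1 : ℂ)), integral_const_mul,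
      integral_const_mul, ih] at key
    simp only [ofReal_zero, ne_eq, Nat.add_eq_zero_iff, one_ne_zero, and_false, not_false_eq_true,
      zero_pow, zero_mul, neg_zero, sub_zero, sub_eq_zero] at key
    rw [Nat.factorial_succ]
    push_cast
    field_simp at key ⊢
    linear_combination key

/-- Differentiation under the integral sign for a dominated family of holomorphic functions. -/
theorem differentiableOn_setIntegral_of_dominated {U : Set ℂ} (hU : IsOpen U) {S : Set ℝ}
    (hS : MeasurableSet S) {G : ℂ → ℝ → ℂ} {b : ℝ → ℝ}
    (hmeas : ∀ w ∈ U, AEStronglyMeasurable (G w) (volume.restrict S))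
    (hdiff : ∀ t ∈ S, DifferentiableOn ℂ (fun w => G w t) U)
    (hbound : ∀ w ∈ U, ∀ t ∈ S, ‖G w t‖ ≤ b t) (hb : IntegrableOn b S) :
    DifferentiableOn ℂ (fun w => ∫ t in S, G w t) U := by
  intro w₀ hw₀
  obtain ⟨r, hr, hrU⟩ := Metric.isOpen_iff.1 hU w₀ hw₀
  set ε := r / 3 with hε
  have hε0 : 0 < ε := by positivity
  have hball : ∀ w ∈ Metric.ball w₀ ε, Metric.closedBall w ε ⊆ U := fun w hw v hv => by
    refine hrU (Metric.mem_ball.2 ?_)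
    have := dist_triangle v w w₀
    linarith [Metric.mem_ball.1 hw, Metric.mem_closedBall.1 hv]
  have hsub : Metric.ball w₀ ε ⊆ U := fun w hw =>
    hball w hw (Metric.mem_closedBall_self hε0.le)
  have hderiv : ∀ t ∈ S, ∀ w ∈ Metric.ball w₀ ε, ‖deriv (fun w => G w t) w‖ ≤ b t / ε := by
    intro t ht w hw
    refine Complex.norm_deriv_le_of_forall_mem_sphere_norm_le hε0 ?_ fun v hv =>
      hbound v (hball w hw (Metric.sphere_subset_closedBall hv)) t ht
    exact ((hdiff t ht).mono
      (Metric.closure_ball_subset_closedBall.trans (hball w hw))).diffContOnCl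
  have hd : ∀ t ∈ S, ∀ w ∈ Metric.ball w₀ ε,
      HasDerivAt (fun w => G w t) (deriv (fun w => G w t) w) w := fun t ht w hw =>
    ((hdiff t ht).differentiableAt (hU.mem_nhds (hsub hw))).hasDerivAt
  have hmeas' : AEStronglyMeasurable (fun t => deriv (fun w => G w t) w₀)
      (volume.restrict S) := by
    -- The derivative is measurable in t as a limit of difference quotients with steps h n, kept
    -- inside the ball of radius ε.
    set h : ℕ → ℂ := fun n => ((ε / (n + 2) : ℝ) : ℂ) with hh
    have hn : ∀ n : ℕ, 0 < ε / (n + 2 : ℝ) := fun n => div_pos hε0 (by positivity)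
    have hmem : ∀ n, w₀ + h n ∈ U := fun n => hsub (by
      rw [Metric.mem_ball, dist_eq_norm, add_sub_cancel_left, hh, norm_real,
        Real.norm_of_nonneg (hn n).le]
      exact div_lt_self hε0 (by have := n.cast_nonneg (α := ℝ); linarith))
    have hlim : Tendsto h atTop (𝓝[≠] 0) := by
      refine tendsto_nhdsWithin_iff.2 ⟨?_, Eventually.of_forall fun n => by
        simpa [hh] using (ofReal_ne_zero.2 (hn n).ne')⟩
      have h1 : Tendsto (fun n : ℕ => ε / ((n : ℝ) + 2)) atTop (𝓝 0) :=
        tendsto_const_nhds.div_atTop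
          (tendsto_atTop_add_const_right _ _ tendsto_natCast_atTop_atTop)
      have h2 := (continuous_ofReal.tendsto 0).comp h1
      rwa [ofReal_zero] at h2
    refine aestronglyMeasurable_of_tendsto_ae atTop
      (f := fun n t => (h n)⁻¹ • (G (w₀ + h n) t - G w₀ t)) (fun n => ?_) ?_
    · have := ((hmeas _ (hmem n)).sub (hmeas _ hw₀)).const_smul (h n)⁻¹
      exact this
    · filter_upwards [ae_restrict_mem hS] with t ht
      exact (hd t ht w₀ (Metric.mem_ball_self hε0)).tendsto_slope_zero.comp hlim
  have key := hasDerivAt_integral_of_dominated_loc_of_deriv_le (μ := volume.restrict S)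
    (F := G) (F' := fun w t => deriv (fun w => G w t) w) (bound := fun t => b t / ε)
    (Metric.ball_mem_nhds w₀ hε0)
    (eventually_of_mem (Metric.ball_mem_nhds w₀ hε0) fun w hw => hmeas w (hsub hw))
    (hb.mono' (hmeas w₀ hw₀) ((ae_restrict_mem hS).mono fun t ht => hbound w₀ hw₀ t ht))
    hmeas' ((ae_restrict_mem hS).mono fun t ht => hderiv t ht) (hb.div_const ε)
    ((ae_restrict_mem hS).mono fun t ht => hd t ht)
  exact key.2.differentiableAt.differentiableWithinAt

/-! ### The Borel transform of a formal solution on a sector -/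

/-- The points of `ℂ \ {0}` with an argument at distance less than `ε` from `d`. -/
def raySector (d ε : ℝ) : Set ℂ := zval '' {w | |zarg w - d| < ε}

theorem raySector_mono {d ε ε' : ℝ} (h : ε ≤ ε') : raySector d ε ⊆ raySector d ε' :=
  image_mono fun _ hw => lt_of_lt_of_le hw h

/-- `φ` is holomorphic on `V`, of exponential type, and approximated by `b` near the origin. -/
structure HasExpExpansion (φ : ℂ → ℂ) (b : PowerSeries ℂ) (V : Set ℂ) : Prop where
  differentiableAt : ∀ ζ ∈ V, DifferentiableAt ℂ φ ζ
  bound : ∃ C A : ℝ, 0 < C ∧ 0 < A ∧ (∀ p, ‖PowerSeries.coeff p b‖ ≤ C * A ^ p) ∧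
    ∀ N : ℕ, ∀ ζ ∈ V, ‖φ ζ - ∑ p ∈ Finset.range N, PowerSeries.coeff p b * ζ ^ p‖
      ≤ C * A ^ N * ‖ζ‖ ^ N * Real.exp ‖ζ‖

theorem HasExpExpansion.mono {φ : ℂ → ℂ} {b : PowerSeries ℂ} {V W : Set ℂ}
    (h : HasExpExpansion φ b V) (hW : W ⊆ V) : HasExpExpansion φ b W := by
  obtain ⟨C, A, hC, hA, hb, h2⟩ := h.bound
  exact ⟨fun ζ hζ => h.differentiableAt ζ (hW hζ),
    C, A, hC, hA, hb, fun N ζ hζ => h2 N ζ (hW hζ)⟩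

theorem hasExpExpansion_polynomial (q : Polynomial ℂ) (V : Set ℂ) :
    HasExpExpansion (fun ζ => q.eval ζ) (q : PowerSeries ℂ) V := by
  refine ⟨fun ζ _ => q.differentiable ζ, ?_⟩
  induction q using Polynomial.induction_on' with
  | add p q hp hq =>
    obtain ⟨C₁, A₁, hC₁, hA₁, hb₁, h₁⟩ := hp
    obtain ⟨C₂, A₂, hC₂, hA₂, hb₂, h₂⟩ := hq
    refine ⟨C₁ + C₂, max A₁ A₂, by positivity, lt_max_of_lt_left hA₁, fun p => ?_,
      fun N ζ hζ => ?_⟩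
    · rw [Polynomial.coe_add, map_add, add_mul]
      refine (norm_add_le _ _).trans (add_le_add ((hb₁ p).trans ?_) ((hb₂ p).trans ?_))
      · gcongr; exact le_max_left _ _
      · gcongr; exact le_max_right _ _
    · rw [Polynomial.coe_add, Polynomial.eval_add]
      simp only [map_add, add_mul, Finset.sum_add_distrib]
      rw [add_sub_add_comm]
      refine (norm_add_le _ _).trans (add_le_add ((h₁ N ζ hζ).trans ?_) ((h₂ N ζ hζ).trans ?_))
      · gcongr; exact le_max_left _ _
      · gcongr; exact le_max_right _ _
  | monomial n c =>
    have hf : (1 : ℝ) ≤ n.factorial := by exact_mod_cast n.factorial_pos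
    refine ⟨(‖c‖ + 1) * n.factorial, 1, by positivity, one_pos, fun p => ?_, fun N ζ _ => ?_⟩
    · rw [Polynomial.coeff_coe, Polynomial.coeff_monomial, one_pow, mul_one]
      split_ifs
      · nlinarith [norm_nonneg c]
      · rw [norm_zero]; positivity
    · simp only [Polynomial.eval_monomial, Polynomial.coeff_coe, Polynomial.coeff_monomial,
        ite_mul, zero_mul, Finset.sum_ite_eq, Finset.mem_range]
      split_ifs with hn
      · rw [sub_self, norm_zero]; positivity
      · rw [sub_zero, norm_mul, norm_pow, one_pow, mul_one]
        obtain ⟨k, rfl⟩ := Nat.exists_eq_add_of_le (not_lt.1 hn)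
        have h1 := Real.pow_div_factorial_le_exp ‖ζ‖ (norm_nonneg _) k
        have hk : (0 : ℝ) < k.factorial := by exact_mod_cast k.factorial_pos
        rw [div_le_iff₀ hk] at h1
        have h2 : (k.factorial : ℝ) ≤ (N + k).factorial := by
          exact_mod_cast Nat.factorial_le (by omega)
        calc ‖c‖ * ‖ζ‖ ^ (N + k) = ‖c‖ * ‖ζ‖ ^ N * ‖ζ‖ ^ k := by ring
          _ ≤ (‖c‖ + 1) * ‖ζ‖ ^ N * (Real.exp ‖ζ‖ * (N + k).factorial) := by
            gcongr
            · linarith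
            · exact h1.trans (by gcongr)
          _ = _ := by ring

/-- After rotation the ray is [0, ∞), at distance δ > 0 from y. Points of modulus at most L lie
within δ/2 of the ray once the angle is below δ/(2L); points of larger modulus are far from y by
size alone. -/
theorem exists_dist_raySector_pos {d : ℝ} {x : ℂ} (hx : x ≠ (‖x‖ : ℂ) * exp (d * I)) :
    ∃ ε c : ℝ, 0 < ε ∧ 0 < c ∧ ∀ ζ ∈ raySector d ε, c ≤ ‖ζ - x‖ := by
  set y := x * exp (-(d * I)) with hy
  have hnorm : ‖exp (-(d * I))‖ = 1 := by simp [norm_exp]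
  have hxy : x = y * exp (d * I) := by rw [hy, mul_assoc, ← exp_add]; simp
  have hclosed : IsClosed {z : ℂ | 0 ≤ z.re ∧ z.im = 0} :=
    (isClosed_le continuous_const continuous_re).inter
      (isClosed_eq continuous_im continuous_const)
  have hmem : y ∉ {z : ℂ | 0 ≤ z.re ∧ z.im = 0} := by
    rintro ⟨h1, h2⟩
    have e : y = (y.re : ℂ) := Complex.ext rfl (by simpa using h2)
    have e2 : ‖x‖ = y.re := by
      have : ‖x‖ = ‖y‖ := by rw [hy, norm_mul, hnorm, mul_one]
      rw [this, e, norm_real, Real.norm_of_nonneg h1, ofReal_re]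
    exact hx (by rw [e2, ← e, ← hxy])
  set δ := Metric.infDist y {z : ℂ | 0 ≤ z.re ∧ z.im = 0} with hδ
  have hδ0 : 0 < δ := (hclosed.notMem_iff_infDist_pos ⟨0, by simp⟩).1 hmem
  set L := 2 * ‖y‖ + 2 with hL
  have hL0 : 0 < L := by positivity
  refine ⟨δ / (2 * L), min (δ / 2) 1, by positivity, by positivity, ?_⟩
  rintro _ ⟨w, hw, rfl⟩
  set u : ℂ := w - d * I with hu
  have him : |u.im| < δ / (2 * L) := by simpa [hu, zarg] using hw
  have e : ‖zval w - x‖ = ‖exp u - y‖ := by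
    have : exp u - y = (zval w - x) * exp (-(d * I)) := by
      rw [sub_mul, zval, ← exp_add, ← hy, ← sub_eq_add_neg]
    rw [this, norm_mul, hnorm, mul_one]
  rw [e]
  by_cases hcase : Real.exp u.re ≤ L
  · refine (min_le_left _ _).trans ?_
    have h1 : δ ≤ ‖(Real.exp u.re : ℂ) - y‖ := by
      rw [norm_sub_rev, ← dist_eq_norm]
      refine Metric.infDist_le_dist_of_mem ⟨?_, ?_⟩
      · rw [ofReal_re]; exact (Real.exp_pos _).le
      · exact ofReal_im _
    have h2 : ‖exp u - (Real.exp u.re : ℂ)‖ ≤ δ / 2 := by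
      have : exp u - (Real.exp u.re : ℂ) = (Real.exp u.re : ℂ) * (exp (I * u.im) - 1) := by
        rw [mul_sub, mul_one, ofReal_exp, ← exp_add, mul_comm I, re_add_im]
      rw [this, norm_mul, norm_real, Real.norm_of_nonneg (Real.exp_pos _).le]
      calc Real.exp u.re * ‖exp (I * u.im) - 1‖ ≤ L * (δ / (2 * L)) := by
            gcongr
            exact (Real.norm_exp_I_mul_ofReal_sub_one_le).trans him.le
        _ = δ / 2 := by field_simp
    have h4 : ((Real.exp u.re : ℂ) - y) - ((Real.exp u.re : ℂ) - exp u) = exp u - y := by ring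
    have h5 := norm_sub_norm_le ((Real.exp u.re : ℂ) - y) ((Real.exp u.re : ℂ) - exp u)
    rw [h4, norm_sub_rev (Real.exp u.re : ℂ) (exp u)] at h5
    linarith
  · refine (min_le_right _ _).trans ?_
    have h1 := norm_sub_norm_le (exp u) y
    rw [norm_exp] at h1
    linarith [norm_nonneg y, not_le.1 hcase]

theorem HasExpExpansion.div_X_sub_C {φ : ℂ → ℂ} {b b' : PowerSeries ℂ} {V : Set ℂ} {x : ℂ}
    (h : HasExpExpansion φ b' V) (hb : (PowerSeries.X - PowerSeries.C x) * b = b') (hx : x ≠ 0)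
    {c : ℝ} (hc : 0 < c) (hV : ∀ ζ ∈ V, c ≤ ‖ζ - x‖) :
    HasExpExpansion (fun ζ => φ ζ / (ζ - x)) b V := by
  have hne : ∀ ζ ∈ V, ζ - x ≠ 0 := fun ζ hζ => norm_pos_iff.1 (hc.trans_le (hV ζ hζ))
  refine ⟨fun ζ hζ => (h.differentiableAt ζ hζ).fun_div (differentiableAt_id.sub_const x)
    (hne ζ hζ), ?_⟩
  obtain ⟨C, A, hC, hA, hb1, h⟩ := h.bound
  have hx0 := norm_pos_iff.2 hx
  have hzero : PowerSeries.coeff 0 b' = -(x * PowerSeries.coeff 0 b) := by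
    rw [← hb, sub_mul, map_sub, PowerSeries.coeff_zero_X_mul, PowerSeries.coeff_C_mul, zero_sub]
  have hsucc : ∀ p, PowerSeries.coeff (p + 1) b' =
      PowerSeries.coeff p b - x * PowerSeries.coeff (p + 1) b := fun p => by
    rw [← hb, sub_mul, map_sub, PowerSeries.coeff_succ_X_mul, PowerSeries.coeff_C_mul]
  -- B‖x‖ ≥ 2 and D‖x‖ = 2C make the bound D B^p stable under x b_{p+1} = b_p - b'_{p+1}, each term
  -- contributing at most C B^{p+1}.
  set B := A + 2 / ‖x‖ + 1 with hB
  set D := 2 * C / ‖x‖ with hD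
  have hq : 0 < 2 / ‖x‖ := by positivity
  have hD0 : 0 < D := by positivity
  have hB1 : 1 ≤ B := by linarith
  have hAB : A ≤ B := by linarith
  have hBx : 2 ≤ B * ‖x‖ := by rw [← div_le_iff₀ hx0]; linarith
  have hDx : D * ‖x‖ = 2 * C := by rw [hD]; field_simp
  have hcoeff : ∀ p, ‖PowerSeries.coeff p b‖ ≤ D * B ^ p := by
    intro p
    refine le_of_mul_le_mul_left ?_ hx0
    rw [← norm_mul]
    induction p with
    | zero =>
      have := hb1 0
      rw [hzero, norm_neg] at this
      nlinarith
    | succ p ih =>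
      have e : x * PowerSeries.coeff (p + 1) b =
          PowerSeries.coeff p b - PowerSeries.coeff (p + 1) b' := by rw [hsucc]; ring
      have ih' : ‖PowerSeries.coeff p b‖ ≤ D * B ^ p := by
        rw [norm_mul] at ih; exact le_of_mul_le_mul_left ih hx0
      have h1 : C * A ^ (p + 1) ≤ C * B ^ (p + 1) := by gcongr
      have h2 : 2 * (D * B ^ p) ≤ (B * ‖x‖) * (D * B ^ p) := by gcongr
      have h3 : ‖x‖ * (D * B ^ (p + 1)) = (D * ‖x‖) * B ^ (p + 1) := by ring
      have h4 : (B * ‖x‖) * (D * B ^ p) = (D * ‖x‖) * B ^ (p + 1) := by ring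
      rw [h4, hDx] at h2
      rw [e, h3, hDx]
      refine (norm_sub_le _ _).trans ((add_le_add ih' ((hb1 _).trans h1)).trans ?_)
      linarith
  -- The product telescopes: the truncations differ by a single boundary term, of the order of the
  -- remainder.
  have hsum : ∀ (N : ℕ) (ζ : ℂ),
      (ζ - x) * ∑ p ∈ Finset.range (N + 1), PowerSeries.coeff p b * ζ ^ p =
      ∑ p ∈ Finset.range (N + 1), PowerSeries.coeff p b' * ζ ^ p +
        PowerSeries.coeff N b * ζ ^ (N + 1) := by
    intro N ζ
    induction N with
    | zero => simp [hzero]; ring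
    | succ N ih =>
      rw [Finset.sum_range_succ, mul_add, ih, Finset.sum_range_succ _ (N + 1), hsucc]
      ring
  refine ⟨(C + D) / c + D, B, by positivity, by positivity, fun p => ?_, fun N ζ hζ => ?_⟩
  · refine (hcoeff p).trans ?_
    gcongr
    have : 0 < (C + D) / c := by positivity
    linarith
  · have hE : 1 ≤ Real.exp ‖ζ‖ := Real.one_le_exp (norm_nonneg _)
    suffices ‖(ζ - x) * (φ ζ / (ζ - x) - ∑ p ∈ Finset.range N, PowerSeries.coeff p b * ζ ^ p)‖ ≤
        (C + D) * B ^ N * ‖ζ‖ ^ N * Real.exp ‖ζ‖ by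
      rw [norm_mul] at this
      have h1 := (mul_le_mul_of_nonneg_right (hV ζ hζ) (norm_nonneg _)).trans this
      rw [← le_div_iff₀' hc] at h1
      refine h1.trans ?_
      rw [mul_div_right_comm, mul_div_right_comm, mul_div_right_comm]
      gcongr
      linarith
    rw [mul_sub, mul_div_cancel₀ _ (hne ζ hζ)]
    rcases N with _ | N
    · have := h 0 ζ hζ
      simp only [Finset.range_zero, Finset.sum_empty, mul_zero, sub_zero, pow_zero, mul_one]
        at this ⊢
      refine this.trans ?_
      gcongr
      linarith
    · rw [hsum, ← sub_sub]
      have h1 : ‖PowerSeries.coeff N b * ζ ^ (N + 1)‖ ≤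
          D * B ^ (N + 1) * ‖ζ‖ ^ (N + 1) * Real.exp ‖ζ‖ := by
        rw [norm_mul, norm_pow]
        calc _ ≤ D * B ^ N * ‖ζ‖ ^ (N + 1) * 1 := by rw [mul_one]; gcongr; exact hcoeff N
          _ ≤ _ := by gcongr; omega
      have h2 : C * A ^ (N + 1) * ‖ζ‖ ^ (N + 1) * Real.exp ‖ζ‖ ≤
          C * B ^ (N + 1) * ‖ζ‖ ^ (N + 1) * Real.exp ‖ζ‖ := by gcongr
      refine (norm_sub_le _ _).trans ((add_le_add ((h (N + 1) ζ hζ).trans h2) h1).trans ?_)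
      apply le_of_eq; ring

/-- The linear factors of P are divided out one at a time, each root being off the ray in direction
d. The series b varies in the induction because P = (X - x)P' is handled by applying the hypothesis
for P' to (X - x)b. -/
theorem exists_hasExpExpansion (d : ℝ) (n : ℕ) : ∀ P : Polynomial ℂ, P.natDegree = n →
    P.eval 0 ≠ 0 → ¬ IsRootDirection P d → ∀ (R : Polynomial ℂ) (b : PowerSeries ℂ),
    (P : PowerSeries ℂ) * b = R →
    ∃ (ε : ℝ) (φ : ℂ → ℂ), 0 < ε ∧ HasExpExpansion φ b (raySector d ε) := by
  induction n with
  | zero =>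
    intro P hdeg h0 _ R b hb
    rw [Polynomial.natDegree_eq_zero] at hdeg
    obtain ⟨c, rfl⟩ := hdeg
    rw [Polynomial.eval_C] at h0
    refine ⟨1, fun ζ => (Polynomial.C c⁻¹ * R).eval ζ, one_pos, ?_⟩
    have e : b = ((Polynomial.C c⁻¹ * R : Polynomial ℂ) : PowerSeries ℂ) := by
      rw [Polynomial.coe_mul, ← hb, ← mul_assoc, ← Polynomial.coe_mul, ← Polynomial.C_mul,
        inv_mul_cancel₀ h0, Polynomial.C_1, Polynomial.coe_one, one_mul]
    rw [e]
    exact hasExpExpansion_polynomial _ _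
  | succ n ih =>
    intro P hdeg h0 hd R b hb
    have hP : P ≠ 0 := fun h => by simp [h] at h0
    obtain ⟨x, hx⟩ := IsAlgClosed.exists_root P (by
      rw [Polynomial.degree_eq_natDegree hP, hdeg]; exact_mod_cast n.succ_ne_zero)
    obtain ⟨P', rfl⟩ := Polynomial.dvd_iff_isRoot.2 hx
    have hP' : P' ≠ 0 := right_ne_zero_of_mul hP
    have hx0 : x ≠ 0 := fun h => h0 (by simp [h])
    have h0' : P'.eval 0 ≠ 0 := fun h => h0 (by simp [h])
    have hd' : ¬ IsRootDirection P' d := fun ⟨y, hy0, hy, hyd⟩ =>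
      hd ⟨y, hy0, by simp [Polynomial.IsRoot.def.1 hy], hyd⟩
    have hdeg' : P'.natDegree = n := by
      rw [Polynomial.natDegree_mul (Polynomial.X_sub_C_ne_zero x) hP',
        Polynomial.natDegree_X_sub_C] at hdeg
      omega
    have hcoe : ((Polynomial.X - Polynomial.C x : Polynomial ℂ) : PowerSeries ℂ) =
        PowerSeries.X - PowerSeries.C x := by
      rw [Polynomial.coe_sub, Polynomial.coe_X, Polynomial.coe_C]
    obtain ⟨ε₁, φ, hε₁, hφ⟩ := ih P' hdeg' h0' hd' R ((PowerSeries.X - PowerSeries.C x) * b) (by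
      rw [← hb, Polynomial.coe_mul, hcoe]; ring)
    obtain ⟨ε₂, c, hε₂, hc, hdist⟩ := exists_dist_raySector_pos (d := d) (x := x)
      fun h => hd ⟨x, hx0, hx, h⟩
    refine ⟨min ε₁ ε₂, _, lt_min hε₁ hε₂,
      (hφ.mono (raySector_mono (min_le_left _ _))).div_X_sub_C rfl hx0 hc fun ζ hζ =>
        hdist ζ (raySector_mono (min_le_right _ _) hζ)⟩

/-! ### The Laplace transform -/

/-- The Laplace integral ∫ φ(ζ) e^{-ζ/z} dζ/z is taken along ζ = t z c with c = (z e^{-id})^{-κ}.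
The ray has argument d + η(arg z - d), inside the thin sector, while |arg c| < π/2 gives decay. As c
is holomorphic in z, one formula covers the whole sector and no contours need gluing. Integrating
t^p against e^{-ct} restores p!, hence f_p z^p. -/
theorem exists_gevreyOn_of_hasExpExpansion {φ : ℂ → ℂ} {f : PowerSeries ℂ} {d ε : ℝ} (hε : 0 < ε)
    (hφ : HasExpExpansion φ (borel f) (raySector d ε)) :
    ∃ (α ρ : ℝ) (F : LogSurface → ℂ), 1 < α ∧ 0 < ρ ∧ DifferentiableOn ℂ F (sector d α ρ) ∧
      GevreyOn F (sector d α ρ) f := by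
  obtain ⟨C, A, hC, hA, -, hφb⟩ := hφ.bound
  -- κα = 1 - η² < 1 keeps Re c positive, and X < 3 with η ≤ ε/4 keeps the ray within angle ε.
  set η := min (1 / 2) (ε / 4) with hη
  have hη0 : 0 < η := by positivity
  have hη1 : η ≤ 1 / 2 := min_le_left _ _
  have hη2 : η ≤ ε / 4 := min_le_right _ _
  set κ := 1 - η with hκ
  set α := 1 + η with hα
  have hκ0 : 0 < κ := by linarith
  set X := Real.pi * α / 2 with hX
  have hX0 : 0 < X := by have := Real.pi_pos; positivity
  have hκX : κ * X < Real.pi / 2 := by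
    have : κ * α < 1 := by rw [hκ, hα]; nlinarith
    rw [hX]; nlinarith [Real.pi_pos]
  have hηX : η * X < ε := by
    have h1 : X < 3 := by rw [hX, hα]; nlinarith [Real.pi_lt_d2]
    nlinarith
  set c₀ := Real.cos (κ * X) with hc₀
  have hc₀pos : 0 < c₀ := Real.cos_pos_of_mem_Ioo ⟨by nlinarith [Real.pi_pos], hκX⟩
  -- For |z| < ρ the growth e^{|ζ|} consumes at most half of the decay e^{-c₀|c|t}.
  set ρ := c₀ / 2 with hρ
  have hρ1 : ρ < 1 := by linarith [Real.cos_le_one (κ * X)]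
  set cf : ℂ → ℂ := fun w => exp (-κ * (w - d * I)) with hcf
  have hcfne : ∀ w, cf w ≠ 0 := fun w => exp_ne_zero _
  have hcfd : Differentiable ℂ cf := by
    intro w; exact (((differentiableAt_id.sub_const _).const_mul _).cexp)
  have hnorm : ∀ w ∈ sector d α ρ, 1 ≤ ‖cf w‖ := by
    rintro w ⟨-, hw⟩
    rw [zval_norm] at hw
    have h1 : w.re ≤ 0 := by
      rw [← Real.exp_le_one_iff]; linarith
    rw [hcf, norm_exp]
    refine Real.one_le_exp ?_
    simp
    nlinarith
  have hre : ∀ w ∈ sector d α ρ, c₀ * ‖cf w‖ ≤ (cf w).re := by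
    rintro w ⟨hw, -⟩
    have him : (-κ * (w - d * I) : ℂ).im = -(κ * (zarg w - d)) := by simp [zarg]
    rw [hcf, norm_exp, exp_re, mul_comm, him, Real.cos_neg]
    refine mul_le_mul_of_nonneg_left ?_ (Real.exp_pos _).le
    rw [← Real.cos_abs (κ * (zarg w - d)), abs_mul, abs_of_pos hκ0]
    refine Real.cos_le_cos_of_nonneg_of_le_pi (by positivity) (by linarith [Real.pi_pos]) ?_
    exact mul_le_mul_of_nonneg_left hw.le hκ0.le
  have hre0 : ∀ w ∈ sector d α ρ, 0 < (cf w).re := fun w hw =>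
    lt_of_lt_of_le (mul_pos hc₀pos (norm_pos_iff.2 (hcfne w))) (hre w hw)
  have hray : ∀ w ∈ sector d α ρ, ∀ t ∈ Ioi (0 : ℝ), (t : ℂ) * (zval w * cf w) ∈
      raySector d ε := by
    rintro w ⟨hw, -⟩ t ht
    refine ⟨(Real.log t : ℂ) + (w + -κ * (w - d * I)), ?_, ?_⟩
    · have e : zarg ((Real.log t : ℂ) + (w + -κ * (w - d * I))) - d = η * (zarg w - d) := by
        simp [zarg, hκ]; ring
      change |_| < ε
      rw [e, abs_mul, abs_of_pos hη0]
      exact (mul_le_mul_of_nonneg_left (le_of_lt hw) hη0.le).trans_lt hηX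
    · rw [zval, exp_add, exp_add, ← ofReal_exp, Real.exp_log ht]; rfl
  set r : ℕ → ℂ → ℂ := fun N ζ =>
    φ ζ - ∑ p ∈ Finset.range N, PowerSeries.coeff p (borel f) * ζ ^ p with hr
  have hbound : ∀ N : ℕ, ∀ w ∈ sector d α ρ, ∀ t ∈ Ioi (0 : ℝ),
      ‖r N (t * (zval w * cf w)) * exp (-(cf w * t))‖ ≤
        C * A ^ N * (‖zval w‖ * ‖cf w‖) ^ N * (t ^ N * Real.exp (-(ρ * ‖cf w‖ * t))) := by
    intro N w hw t ht
    have ht0 : 0 < t := ht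
    have hζ : ‖(t : ℂ) * (zval w * cf w)‖ = t * (‖zval w‖ * ‖cf w‖) := by
      rw [norm_mul, norm_mul, norm_real, Real.norm_of_nonneg ht0.le]
    rw [norm_mul, norm_exp]
    have h1 := hφb N _ (hray w hw t ht)
    rw [hζ] at h1
    have h2 : (-(cf w * t)).re = -((cf w).re * t) := by simp
    rw [h2]
    calc _ ≤ C * A ^ N * (t * (‖zval w‖ * ‖cf w‖)) ^ N * Real.exp (t * (‖zval w‖ * ‖cf w‖)) *
          Real.exp (-((cf w).re * t)) := by gcongr
      _ = C * A ^ N * (t * (‖zval w‖ * ‖cf w‖)) ^ N *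
          Real.exp (t * (‖zval w‖ * ‖cf w‖) + -((cf w).re * t)) := by
          rw [mul_assoc (_ * _), ← Real.exp_add]
      _ ≤ C * A ^ N * (t * (‖zval w‖ * ‖cf w‖)) ^ N * Real.exp (-(ρ * ‖cf w‖ * t)) := by
          gcongr
          have h3 : t * (‖zval w‖ * ‖cf w‖) ≤ t * (ρ * ‖cf w‖) := by
            gcongr; exact hw.2.le
          have h4 : c₀ * ‖cf w‖ * t ≤ (cf w).re * t := by gcongr; exact hre w hw
          have h5 : c₀ = 2 * ρ := by rw [hρ]; ring
          rw [h5] at h4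
          linarith
      _ = _ := by rw [mul_pow]; ring
  have hcont : ∀ w ∈ sector d α ρ,
      ContinuousOn (fun t : ℝ => φ (t * (zval w * cf w)) * exp (-(cf w * t))) (Ioi 0) := by
    intro w hw t ht
    have h1 : ContinuousAt (fun t : ℝ => φ (t * (zval w * cf w))) t :=
      ContinuousAt.comp (f := fun t : ℝ => (t : ℂ) * (zval w * cf w))
        (hφ.differentiableAt _ (hray w hw t ht)).continuousAt
        (Continuous.continuousAt (by fun_prop))
    exact (h1.mul (Continuous.continuousAt (by fun_prop))).continuousWithinAt
  have hmeas : ∀ w ∈ sector d α ρ, AEStronglyMeasurable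
      (fun t : ℝ => φ (t * (zval w * cf w)) * exp (-(cf w * t))) (volume.restrict (Ioi 0)) :=
    fun w hw => (hcont w hw).aestronglyMeasurable measurableSet_Ioi
  have hρ0 : 0 < ρ := by positivity
  have hbound0 : ∀ w ∈ sector d α ρ, ∀ t ∈ Ioi (0 : ℝ),
      ‖φ (t * (zval w * cf w)) * exp (-(cf w * t))‖ ≤ C * (t ^ 0 * Real.exp (-(ρ * t))) := by
    intro w hw t ht
    have h1 := hbound 0 w hw t ht
    simp only [hr, Finset.range_zero, Finset.sum_empty, sub_zero, pow_zero, mul_one, one_mul]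
      at h1 ⊢
    refine h1.trans ?_
    have ht0 : 0 < t := ht
    have h2 := hnorm w hw
    gcongr
    exact le_mul_of_one_le_right hρ0.le h2
  have hint0 : ∀ w ∈ sector d α ρ, IntegrableOn
      (fun t : ℝ => φ (t * (zval w * cf w)) * exp (-(cf w * t))) (Ioi 0) := fun w hw =>
    ((integrableOn_pow_mul_exp_neg_mul_Ioi 0 hρ0).const_mul C).mono' (hmeas w hw)
      ((ae_restrict_mem measurableSet_Ioi).mono fun t ht => hbound0 w hw t ht)
  refine ⟨α, ρ, fun w => cf w * ∫ t in Ioi (0 : ℝ), φ (t * (zval w * cf w)) * exp (-(cf w * t)),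
    by linarith, hρ0, ?_, ?_⟩
  · refine hcfd.differentiableOn.mul ?_
    refine differentiableOn_setIntegral_of_dominated (sector_isOpen d α ρ) measurableSet_Ioi hmeas
      ?_ hbound0 ((integrableOn_pow_mul_exp_neg_mul_Ioi 0 hρ0).const_mul C)
    intro t ht w hw
    have h1 : DifferentiableAt ℂ (fun w => (t : ℂ) * (zval w * cf w)) w :=
      ((hasDerivAt_zval w).differentiableAt.fun_mul (hcfd w)).const_mul _
    have h2 : DifferentiableAt ℂ (fun w => φ (t * (zval w * cf w))) w :=
      DifferentiableAt.comp (f := fun w => (t : ℂ) * (zval w * cf w)) w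
        (hφ.differentiableAt _ (hray w hw t ht)) h1
    exact (h2.fun_mul ((hcfd w).mul_const _).fun_neg.cexp).differentiableWithinAt
  · refine ⟨C / ρ, A / ρ, by positivity, by positivity, fun N w hw => ?_⟩
    have hterm : ∀ p ∈ Finset.range N, IntegrableOn (fun t : ℝ =>
        PowerSeries.coeff p (borel f) * (zval w * cf w) ^ p * ((t : ℂ) ^ p * exp (-(cf w * t))))
        (Ioi 0) := fun p _ => (integrableOn_pow_mul_cexp_neg_mul_Ioi p (hre0 w hw)).const_mul _
    have hsplit : cf w * ∫ t in Ioi (0 : ℝ), r N (t * (zval w * cf w)) * exp (-(cf w * t)) =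
        cf w * (∫ t in Ioi (0 : ℝ), φ (t * (zval w * cf w)) * exp (-(cf w * t))) -
          ∑ p ∈ Finset.range N, PowerSeries.coeff p f * zval w ^ p := by
      have e : ∀ t : ℝ, r N (t * (zval w * cf w)) * exp (-(cf w * t)) =
          φ (t * (zval w * cf w)) * exp (-(cf w * t)) - ∑ p ∈ Finset.range N,
            PowerSeries.coeff p (borel f) * (zval w * cf w) ^ p *
              ((t : ℂ) ^ p * exp (-(cf w * t))) := by
        intro t
        simp only [hr, sub_mul, Finset.sum_mul]
        congr 1
        exact Finset.sum_congr rfl fun p _ => by rw [mul_pow]; ring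
      simp only [e]
      rw [integral_sub (hint0 w hw) (integrable_finsetSum _ hterm),
        integral_finsetSum _ hterm, mul_sub, Finset.mul_sum]
      congr 1
      refine Finset.sum_congr rfl fun p _ => ?_
      rw [integral_const_mul, integral_pow_mul_cexp_neg_mul_Ioi p (hre0 w hw), coeff_borel]
      have h1 : (p.factorial : ℂ) ≠ 0 := by exact_mod_cast p.factorial_ne_zero
      have h2 := hcfne w
      field_simp
      ring
    rw [← hsplit, norm_mul]
    have hc1 : 0 < ‖cf w‖ := norm_pos_iff.2 (hcfne w)
    have hρc : 0 < ρ * ‖cf w‖ := by positivity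
    have h1 := norm_integral_le_of_norm_le
      ((integrableOn_pow_mul_exp_neg_mul_Ioi N hρc).const_mul
        (C * A ^ N * (‖zval w‖ * ‖cf w‖) ^ N))
      ((ae_restrict_mem measurableSet_Ioi).mono fun t ht => hbound N w hw t ht)
    rw [integral_const_mul, integral_pow_mul_exp_neg_mul_Ioi N hρc] at h1
    refine (mul_le_mul_of_nonneg_left h1 hc1.le).trans (le_of_eq ?_)
    clear_value ρ
    rw [mul_pow, mul_pow, div_pow]
    field_simp
    ring

/-! ### Geometry of sectors and 1-summability of formal solutions -/

theorem sector_mono {d β β' ρ ρ' : ℝ} (hβ : β ≤ β') (hρ : ρ ≤ ρ') :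
    sector d β ρ ⊆ sector d β' ρ' := fun _ hw =>
  ⟨hw.1.trans_le (by have := Real.pi_pos; gcongr), hw.2.trans_le hρ⟩

theorem sector_eq (d β : ℝ) {ρ : ℝ} (hρ : 0 < ρ) :
    sector d β ρ = {w | |w.im - d| < Real.pi * β / 2 ∧ w.re < Real.log ρ} := by
  ext w
  simp only [sector, zval_norm, zarg, mem_ofPred_eq, Real.lt_log_iff_exp_lt hρ]

theorem convex_sector (d β : ℝ) {ρ : ℝ} (hρ : 0 < ρ) : Convex ℝ (sector d β ρ) := by
  have e : sector d β ρ = Complex.imCLM ⁻¹' (Metric.ball d (Real.pi * β / 2)) ∩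
      Complex.reCLM ⁻¹' (Iio (Real.log ρ)) := by
    rw [sector_eq d β hρ]; ext w; simp [Real.dist_eq]
  rw [e]
  exact ((convex_ball d _).linear_preimage Complex.imCLM.toLinearMap).inter
    ((convex_Iio _).linear_preimage Complex.reCLM.toLinearMap)

theorem sector_nonempty (d : ℝ) {β ρ : ℝ} (hβ : 0 < β) (hρ : 0 < ρ) :
    (sector d β ρ).Nonempty := by
  rw [sector_eq d β hρ]
  refine ⟨⟨Real.log ρ - 1, d⟩, ?_, ?_⟩
  · have := Real.pi_pos
    simp only [sub_self, abs_zero]; positivity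
  · simp

theorem isSectorialRegion_sector (d : ℝ) {α ρ : ℝ} (hα : 0 < α) (hρ : 0 < ρ) :
    IsSectorialRegion (sector d α ρ) d α where
  isOpen := sector_isOpen d α ρ
  isConnected := ⟨sector_nonempty d hα hρ, (convex_sector d α hρ).isPreconnected⟩
  subset := fun _ hw => hw.1
  exists_sector := fun _ _ hβ => ⟨ρ, hρ, sector_mono hβ.le le_rfl⟩

theorem closure_sector_subset (d β ρ : ℝ) :
    closure (sector d β ρ) ⊆ {w | |zarg w - d| ≤ Real.pi * β / 2 ∧ ‖zval w‖ ≤ ρ} := by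
  refine closure_minimal (fun w hw => ⟨hw.1.le, hw.2.le⟩) ?_
  have h1 : IsClosed {w : ℂ | |w.im - d| ≤ Real.pi * β / 2} :=
    isClosed_le (Complex.continuous_im.sub continuous_const).abs continuous_const
  have h2 : IsClosed {w : ℂ | ‖Complex.exp w‖ ≤ ρ} :=
    isClosed_le Complex.continuous_exp.norm continuous_const
  exact h1.inter h2

theorem GevreyOn.mono {F : LogSurface → ℂ} {S T : Set LogSurface} {f : PowerSeries ℂ}
    (h : GevreyOn F T f) (hST : S ⊆ T) : GevreyOn F S f := by
  obtain ⟨C, A, hC, hA, h⟩ := h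
  exact ⟨C, A, hC, hA, fun N w hw => h N w (hST hw)⟩

theorem isOneSummable_of_formalSolution {P Q : Polynomial ℂ} {f : PowerSeries ℂ} {d : ℝ}
    (hP : P.eval 0 ≠ 0) (h : IsFormalSolution P Q f) (hd : ¬ IsRootDirection P d) :
    IsOneSummable f d := by
  obtain ⟨R, hR⟩ := exists_polynomial_borel Q
  rw [isFormalSolution_iff, ← hR] at h
  obtain ⟨ε, φ, hε, hφ⟩ := exists_hasExpExpansion d _ P rfl hP hd R _ h
  obtain ⟨α, ρ, F, hα, hρ, hF, hG⟩ := exists_gevreyOn_of_hasExpExpansion hε hφ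
  exact ⟨_, F, ⟨α, hα, isSectorialRegion_sector d (by linarith) hρ⟩, hF,
    fun d' θ' ρ' _ _ hsub => hG.mono (subset_closure.trans hsub)⟩

/-! ### The equation for the `1`-sums -/

theorem DifferentiableOn.actualOp {F : LogSurface → ℂ} {G : Set LogSurface} (hG : IsOpen G)
    (hF : DifferentiableOn ℂ F G) : DifferentiableOn ℂ (actualOp F) G := by
  have : RamisSum.actualOp F = fun w => zval w * (deriv F w + F w) :=
    funext (actualOp_apply F)
  rw [this]
  exact (show Differentiable ℂ zval from fun w =>
    (hasDerivAt_zval w).differentiableAt).differentiableOn.fun_mul ((hF.deriv hG).fun_add hF)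

/-- The function `P(z² ∂_z + z) F`. -/
noncomputable def polyOp (P : Polynomial ℂ) (F : LogSurface → ℂ) : LogSurface → ℂ :=
  fun w => P.sum (fun n c => c * (actualOp^[n] F) w)

theorem polyOp_add (P R : Polynomial ℂ) (F : LogSurface → ℂ) :
    polyOp (P + R) F = fun w => polyOp P F w + polyOp R F w :=
  funext fun _ => Polynomial.sum_add_index P R _ (fun _ => zero_mul _) fun _ _ _ => add_mul _ _ _

theorem polyOp_monomial (n : ℕ) (c : ℂ) (F : LogSurface → ℂ) :
    polyOp (Polynomial.monomial n c) F = fun w => c * (actualOp^[n] F) w :=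
  funext fun _ => Polynomial.sum_monomial_index _ _ (zero_mul _)

theorem differentiableOn_iterate_actualOp {F : LogSurface → ℂ} {G : Set LogSurface}
    (hG : IsOpen G) (hF : DifferentiableOn ℂ F G) (n : ℕ) :
    DifferentiableOn ℂ (actualOp^[n] F) G := by
  induction n with
  | zero => exact hF
  | succ n ih => rw [Function.iterate_succ_apply']; exact DifferentiableOn.actualOp hG ih

theorem differentiableOn_polyOp {F : LogSurface → ℂ} {G : Set LogSurface} (hG : IsOpen G)
    (hF : DifferentiableOn ℂ F G) (P : Polynomial ℂ) : DifferentiableOn ℂ (polyOp P F) G := by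
  induction P using Polynomial.induction_on' with
  | add p q hp hq => rw [polyOp_add]; exact hp.fun_add hq
  | monomial n c =>
    rw [polyOp_monomial]; exact (differentiableOn_iterate_actualOp hG hF n).const_mul c

/-- Every application of the operator costs some of the sector, so the estimate is carried for all
smaller sectors at once. -/
theorem gevreyOn_iterate_actualOp {F : LogSurface → ℂ} {f : PowerSeries ℂ} {d β ρ : ℝ}
    (hF : DifferentiableOn ℂ F (sector d β ρ))
    (h : ∀ β' ρ', 0 < β' → β' < β → 0 < ρ' → ρ' < ρ → GevreyOn F (sector d β' ρ') f) (n : ℕ) :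
    ∀ β' ρ', 0 < β' → β' < β → 0 < ρ' → ρ' < ρ →
      GevreyOn (actualOp^[n] F) (sector d β' ρ') ((formalOp ^ n) f) := by
  induction n with
  | zero => simpa using h
  | succ n ih =>
    intro β' ρ' hβ0 hβ hρ0 hρ
    obtain ⟨β₁, h1, h2⟩ := exists_between hβ
    obtain ⟨ρ₁, h3, h4⟩ := exists_between hρ
    rw [Function.iterate_succ_apply', pow_succ', Module.End.mul_apply]
    exact (ih β₁ ρ₁ (hβ0.trans h1) h2 (hρ0.trans h3) h4).actualOp
      ((differentiableOn_iterate_actualOp (sector_isOpen d β ρ) hF n).mono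
        (sector_mono h2.le h4.le)) h1 hρ0 h3

theorem gevreyOn_polyOp {F : LogSurface → ℂ} {f : PowerSeries ℂ} {d β ρ : ℝ}
    (hF : DifferentiableOn ℂ F (sector d β ρ))
    (h : ∀ β' ρ', 0 < β' → β' < β → 0 < ρ' → ρ' < ρ → GevreyOn F (sector d β' ρ') f)
    (P : Polynomial ℂ) {β' ρ' : ℝ} (hβ0 : 0 < β') (hβ : β' < β) (hρ0 : 0 < ρ') (hρ : ρ' < ρ) :
    GevreyOn (polyOp P F) (sector d β' ρ') (Polynomial.aeval formalOp P f) := by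
  induction P using Polynomial.induction_on' with
  | add p q hp hq =>
    rw [polyOp_add, map_add, LinearMap.add_apply]; exact hp.add hq
  | monomial n c =>
    rw [polyOp_monomial, Polynomial.aeval_monomial, Module.End.mul_apply,
      Module.algebraMap_end_apply]
    exact (gevreyOn_iterate_actualOp hF h n β' ρ' hβ0 hβ hρ0 hρ).const_mul c

/-- On some sector of opening larger than `π`, the defect `P(z² ∂_z + z) F - Q` of a `1`-sum `F`
is asymptotic to the formal defect. -/
theorem IsOneSum.exists_gevreyOn_defect {f : PowerSeries ℂ} {d : ℝ} {G : Set LogSurface}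
    {F : LogSurface → ℂ} (h : IsOneSum f d G F) (P Q : Polynomial ℂ) :
    ∃ β ρ : ℝ, 1 < β ∧ 0 < ρ ∧ sector d β ρ ⊆ G ∧
      GevreyOn (fun w => polyOp P F w - Q.eval (zval w)) (sector d β ρ)
        (Polynomial.aeval formalOp P f - (Q : PowerSeries ℂ)) := by
  obtain ⟨⟨α, hα, hG⟩, hF, hexp⟩ := h
  obtain ⟨β, hβ1, hβα⟩ := exists_between hα
  obtain ⟨ρ, hρ, hsub⟩ := hG.exists_sector β (by linarith) hβα
  obtain ⟨β', h1, h2⟩ := exists_between hβ1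
  have hρ2 : ρ / 2 < ρ := by linarith
  refine ⟨β', ρ / 2, h1, by positivity, (sector_mono h2.le hρ2.le).trans hsub, ?_⟩
  have hP := gevreyOn_polyOp (hF.mono hsub) (f := f) (fun β₁ ρ₁ h3 h4 h5 h6 =>
    hexp d β₁ ρ₁ h3 h5 ((closure_sector_subset d β₁ ρ₁).trans fun w hw => hsub
      ⟨hw.1.trans_lt (by have := Real.pi_pos; gcongr), hw.2.trans_lt h6⟩)) P
    (β' := β') (ρ' := ρ / 2) (by linarith) h2 (by positivity) hρ2
  have := hP.add ((gevreyOn_polynomial Q d β' (ρ / 2)).const_mul (-1))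
  simpa only [neg_one_mul, neg_smul, one_smul, ← sub_eq_add_neg] using this

theorem isActualSolution_of_isFormalSolution {P Q : Polynomial ℂ} {f : PowerSeries ℂ} {d : ℝ}
    {G : Set LogSurface} {F : LogSurface → ℂ} (hf : IsFormalSolution P Q f)
    (h : IsOneSum f d G F) : IsActualSolution P Q G F := by
  obtain ⟨β, ρ, hβ, hρ, hsub, hgev⟩ := h.exists_gevreyOn_defect P Q
  rw [hf, sub_self] at hgev
  obtain ⟨⟨α, -, hG⟩, hF, -⟩ := h
  have hd : DifferentiableOn ℂ (fun w => polyOp P F w - Q.eval (zval w)) G :=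
    (differentiableOn_polyOp hG.isOpen hF P).fun_sub (Differentiable.differentiableOn fun w =>
      (Q.differentiable _).comp w (hasDerivAt_zval w).differentiableAt)
  obtain ⟨w₀, hw₀, hzero⟩ := watson hβ hρ (hd.mono hsub) hgev
  have := (hd.analyticOnNhd hG.isOpen).eqOn_zero_of_preconnected_of_eventuallyEq_zero
    hG.isConnected.isPreconnected (hsub hw₀) hzero
  exact fun w hw => sub_eq_zero.1 (this hw)

theorem isFormalSolution_of_isActualSolution {P Q : Polynomial ℂ} {f : PowerSeries ℂ} {d : ℝ}
    {G : Set LogSurface} {F : LogSurface → ℂ} (hs : IsActualSolution P Q G F)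
    (h : IsOneSum f d G F) : IsFormalSolution P Q f := by
  obtain ⟨β, ρ, hβ, hρ, hsub, C, A, hC, hA, hgev⟩ := h.exists_gevreyOn_defect P Q
  refine sub_eq_zero.1 (GevreyOn.eq_zero (d := d) (β := β) (ρ := ρ) (by linarith) hρ
    ⟨C, A, hC, hA, fun N w hw => ?_⟩)
  have e : polyOp P F w - Q.eval (zval w) = 0 := sub_eq_zero.2 (hs w (hsub hw))
  simpa only [e] using hgev N w hw

/-- Choosing a root for every direction would inject (-π, π), via the principal argument, into a
finite set. -/
theorem exists_not_isRootDirection {h : Polynomial ℂ} (h0 : h ≠ 0) :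
    ∃ d : ℝ, ¬ IsRootDirection h d := by
  by_contra! hall
  choose x hx0 hx hxd using hall
  have hinj : InjOn x (Ioo (-Real.pi) Real.pi) := by
    intro s hs t ht hst
    have harg : ∀ u ∈ Ioo (-Real.pi) Real.pi, (x u).arg = u := fun u hu => by
      rw [hxd u, exp_mul_I]
      exact arg_mul_cos_add_sin_mul_I (norm_pos_iff.2 (hx0 u)) ⟨hu.1, hu.2.le⟩
    rw [← harg s hs, ← harg t ht, hst]
  have hfin : (x '' Ioo (-Real.pi) Real.pi).Finite :=
    (Polynomial.finite_setOfPred_isRoot h0).subset (by rintro _ ⟨u, -, rfl⟩; exact hx u)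
  exact Ioo_infinite (by linarith [Real.pi_pos]) (hfin.of_finite_image hinj)

end

end RamisSum

/-! ### The equivalence of the three statements -/

theorem mainTheorem1 (f : PowerSeries ℂ) (hf : PowerSeries.constantCoeff f = 0) :
    List.TFAE [
      -- (1) `f` formally solves such an equation
      ∃ P Q : Polynomial ℂ, P.eval 0 ≠ 0 ∧ RamisSum.IsFormalSolution P Q f,
      -- (2) the recursion holds, with `r ≥ 1` the smallest possible order
      ∃ (r : ℕ) (a : Fin r → ℂ), 1 ≤ r ∧ RamisSum.SatisfiesRecursion f r a ∧
        ∀ r' : ℕ, 1 ≤ r' → (∃ a' : Fin r' → ℂ, RamisSum.SatisfiesRecursion f r' a') → r ≤ r',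
      -- (3) `f` is `1`-summable off the root directions, and its sum solves such an equation
      ∃ (r : ℕ) (a : Fin r → ℂ) (P Q : Polynomial ℂ), 1 ≤ r ∧ P.eval 0 ≠ 0 ∧
        ∀ d : ℝ, ¬ RamisSum.IsRootDirection (RamisSum.charPoly a) d →
          RamisSum.IsOneSummable f d ∧
          ∀ (G : Set RamisSum.LogSurface) (F : RamisSum.LogSurface → ℂ),
            RamisSum.IsOneSum f d G F → RamisSum.IsActualSolution P Q G F] := by
  tfae_have 1 → 2 := by
    rintro ⟨P, Q, hP, h⟩
    have hex : ∃ r : ℕ, 1 ≤ r ∧ ∃ a : Fin r → ℂ, RamisSum.SatisfiesRecursion f r a := by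
      obtain ⟨r, a, hr, ha⟩ := RamisSum.exists_recursion_of_formalSolution hP h
      exact ⟨r, hr, a, ha⟩
    classical
    obtain ⟨hr, a, ha⟩ := Nat.find_spec hex
    exact ⟨_, a, hr, ha, fun r' hr' ha' => Nat.find_min' hex ⟨hr', ha'⟩⟩
  tfae_have 2 → 1 := by
    rintro ⟨r, a, -, h, -⟩
    exact RamisSum.exists_formalSolution_of_recursion h
  tfae_have 1 → 3 := by
    rintro ⟨P, Q, hP, h⟩
    -- The polynomial of (3) is P / P(0), so both have the same root directions; the 1 ensures r ≥ 1
    -- when P is constant.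
    obtain ⟨a, ha⟩ := RamisSum.exists_charPoly_eq P hP (r := P.natDegree + 1) (by omega)
    refine ⟨_, a, P, Q, by omega, hP, fun d hd =>
      ⟨RamisSum.isOneSummable_of_formalSolution hP h fun ⟨x, hx0, hx, hxd⟩ =>
        hd ⟨x, hx0, ?_, hxd⟩,
      fun G F hF => RamisSum.isActualSolution_of_isFormalSolution h hF⟩⟩
    rw [ha, Polynomial.IsRoot.def, Polynomial.eval_mul, Polynomial.eval_C] at hx
    exact (mul_eq_zero.1 hx).resolve_left hP
  tfae_have 3 → 1 := by
    rintro ⟨r, a, P, Q, -, hP, h⟩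
    obtain ⟨d, hd⟩ := RamisSum.exists_not_isRootDirection (h := RamisSum.charPoly a) fun h0 => by
      simpa [h0] using RamisSum.eval_zero_charPoly a
    obtain ⟨⟨G, F, hF⟩, hsol⟩ := h d hd
    exact ⟨P, Q, hP, RamisSum.isFormalSolution_of_isActualSolution (hsol G F hF) hF⟩
  tfae_finish
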